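/- Let $\Sigma$ be a finite nonempty alphabet, fix a padding symbol $\Box\in\Sigma$, and let $L\subseteq\Sigma^*$ be a regular language. For $n\in\mathbb{N}$ and $x\in\Sigma^*$ let $\mathrm{last}_n(x)\in\Sigma^n$ be the suffix of length $n$ of $x$, where $x$ is padded on the left with $\Box$ if $|x|<n$, and let $\mathrm{SW}_n(L)=\{x\in\Sigma^*\mid \mathrm{last}_n(x)\in L\}$. A randomized streaming algorithm is a probabilistic automaton $\mathcal P=(Q,\Sigma,\iota,\rho,F)$ with a nonempty state set $Q$, an initial distribution $\iota$ on $Q$, transition probabilities $\rho(p,a,\cdot)$ (a distribution on $Q$ for all $p\in Q$, $a\in\Sigma$), and final states $F\subseteq Q$; it accepts $x$ with the probability that its random state after reading $x$ lies in $F$, and rejects $x$ with the complementary probability. Let $\mathsf F^{\mathsf r}_L(n)$ be the minimum of $\log_2|Q|$ over all such automata that accept every $x\in \mathrm{SW}_n(L)$ with probability at least $2/3$ and reject every $x\in\Sigma^*\setminus \mathrm{SW}_n(L)$ with probability at least $2/3$. Let $\mathbf{Len}$ be the class of regular languages $K\subseteq\Sigma^*$ such that for every $n\ge 0$ either $\Sigma^n\subseteq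 K$ or $\Sigma^n\cap K=\emptyset$; let $\mathbf{ST}$ be the class of finite Boolean combinations of languages $\Sigma^*w$ with $w\in\Sigma^*$; let $\mathbf{SF}$ be the class of regular languages $K\subseteq\Sigma^*$ such that $xy\in K$ and $x\ne\varepsilon$ imply $y\notin K$; and let $\mathbf{LI}$ be the class of languages $\Sigma^*K$ with $K\subseteq\Sigma^*$ regular. Let $\langle\mathbf L_1,\dots,\mathbf L_k\rangle$ be the class of finite Boolean combinations of languages in $\mathbf L_1\cup\dots\cup\mathbf L_k$. For $f,g\colon\mathbb N\to\mathbb R$ write $f=\bar\Omega(g)$ if there is $c>0$ with $f(n)\ge c\,g(n)$ for infinitely many $n$, and $f=\bar\Theta(g)$ if $f=O(g)$ and $f=\bar\Omega(g)$. All logarithms have base two. Then $\mathsf F^{\mathsf r}_L(n)$ is $\Theta(1)$, $\bar\Theta(\log\log n)$, $\bar\Theta(\log n)$ or $\bar\Theta(n)$, where $\Theta(1)$ means that $\mathsf F^{\mathsf r}_L$ is bounded and that there is $c>0$ with $\mathsf F^{\mathsf r}_L(n)\ge c$ for every $n$ with $\emptyset\ne L\cap\Sigma^n\neq\Sigma^n$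 (for all other $n$ one has $\mathsf F^{\mathsf r}_L(n)=0$). Furthermore, \begin{align*} \mathsf F^{\mathsf r}_L(n)=O(1)&\iff L\in\langle\mathbf{ST},\mathbf{Len}\rangle,\\ \mathsf F^{\mathsf r}_L(n)=O(\log\log n)&\iff L\in\langle\mathbf{ST},\mathbf{SF},\mathbf{Len}\rangle,\\ \mathsf F^{\mathsf r}_L(n)=O(\log n)&\iff L\in\langle\mathbf{LI},\mathbf{Len}\rangle, \end{align*} and \begin{align*} L\notin\langle\mathbf{ST},\mathbf{Len}\rangle&\implies \mathsf F^{\mathsf r}_L(n)=\bar\Omega(\log\log n),\\ L\notin\langle\mathbf{ST},\mathbf{SF},\mathbf{Len}\rangle&\implies \mathsf F^{\mathsf r}_L(n)=\bar\Omega(\log n),\\ L\notin\langle\mathbf{LI},\mathbf{Len}\rangle&\implies \mathsf F^{\mathsf r}_L(n)=\bar\Omega(n). \end{align*} -/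

import Mathlib

namespace SlidingWindow

open Filter Asymptotics

/-! ### Randomized streaming algorithms -/

/-- A probabilistic automaton (randomized streaming algorithm) over the alphabet `α` with state
set `σ`. A `PMF` is a function with values in `[0,1]` that sums to one, so `σ` is nonempty. -/
structure ProbAutomaton (α : Type*) (σ : Type*) where
  /-- initial state distribution -/
  init : PMF σ
  /-- transition probabilities -/
  step : σ → α → PMF σ
  /-- final states -/
  accept : Set σ

namespace ProbAutomaton

variable {α σ : Type*}

/-- The distribution of the state reached after reading `w`:
`Pr[P(wa) = q] = ∑ p, Pr[P(w) = p] * ρ(p, a, q)`. -/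
noncomputable def dist (P : ProbAutomaton α σ) (w : List α) : PMF σ :=
  w.foldl (fun μ a => μ.bind fun p => P.step p a) P.init

/-- The probability that `w` is accepted. -/
noncomputable def acceptProb (P : ProbAutomaton α σ) (w : List α) : ℝ :=
  ((P.dist w).toOuterMeasure P.accept).toReal

/-- The probability that `w` is rejected. -/
noncomputable def rejectProb (P : ProbAutomaton α σ) (w : List α) : ℝ :=
  ((P.dist w).toOuterMeasure P.acceptᶜ).toReal

/-- `P` is a randomized streaming algorithm for `L` with two-sided error probability `err`. -/
def IsFor (P : ProbAutomaton α σ) (L : Language α) (err : ℝ) : Prop :=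
  (∀ w ∈ L, 1 - err ≤ P.acceptProb w) ∧ (∀ w ∉ L, 1 - err ≤ P.rejectProb w)

end ProbAutomaton

/-! ### The fixed-size sliding window model -/

/-- The window of length `n`: the last `n` symbols of the stream `x`, padded on the left by the
symbol `pad` if `x` is shorter than `n`. -/
def lastN {α : Type*} (pad : α) (n : ℕ) (x : List α) : List α :=
  (List.replicate (n - x.length) pad ++ x).rtake n

/-- The sliding window problem for `L` and window length `n`. -/
def SW {α : Type*} (pad : α) (n : ℕ) (L : Language α) : Language α :=
  {x | lastN pad n x ∈ L}

theorem lastN_length {α : Type*} (pad : α) (n : ℕ) (x : List α) :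
    (lastN pad n x).length = n := by
  simp [lastN, List.rtake]
  omega

theorem lastN_snoc {α : Type*} (pad : α) (n : ℕ) (x : List α) (a : α) :
    lastN pad n (x ++ [a]) = lastN pad n (lastN pad n x ++ [a]) := by
  rcases Nat.eq_zero_or_pos n with rfl | hn
  · simp [lastN, List.rtake]
  · have h1 : n - (lastN pad n x ++ [a]).length = 0 := by simp [lastN_length]
    rw [lastN.eq_1 pad n (lastN pad n x ++ [a]), h1]
    simp only [lastN, List.rtake, List.replicate_zero, List.nil_append, List.length_append,
      List.length_replicate, List.length_drop, List.length_singleton]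
    by_cases h : n ≤ x.length
    · have h2 : n - x.length = 0 := by omega
      have h3 : n - (x.length + 1) = 0 := by omega
      simp only [h2, h3, List.replicate_zero, List.nil_append, Nat.zero_add]
      rw [List.drop_append_of_le_length (by omega), List.drop_append_of_le_length
        (by simp; omega), List.drop_drop]
      congr 2
      omega
    · have h2 : n - x.length + x.length - n = 0 := by omega
      have h3 : n - (x.length + 1) + (x.length + 1) - n = 0 := by omega
      have h4 : n - x.length = n - (x.length + 1) + 1 := by omega
      rw [h2, h3, h4]
      simp only [List.drop_zero, List.replicate_succ, List.cons_append, List.append_assoc]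
      have h5 : n - (x.length + 1) + 1 + x.length -
          0 + 1 - n = 1 := by omega
      rw [h5]
      simp

/-- The trivial algorithm, which stores the window, has finitely many states. -/
theorem spaceSet_nonempty {α : Type*} [Finite α] (pad : α) (L : Language α) (n : ℕ) :
    {s : ℝ | ∃ (σ : Type) (_ : Finite σ) (P : ProbAutomaton α σ),
      P.IsFor (SW pad n L) (1 / 3) ∧ s = Real.logb 2 (Nat.card σ)}.Nonempty := by
  classical
  have : Finite {l : List α // l.length = n} := (List.finite_length_eq α n).to_subtype
  obtain ⟨k, ⟨e⟩⟩ := Finite.exists_equiv_fin {l : List α // l.length = n}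
  let f : List α → Fin k := fun x => e ⟨lastN pad n x, lastN_length pad n x⟩
  let P : ProbAutomaton α (Fin k) :=
    { init := PMF.pure (f [])
      step := fun q a => PMF.pure (f ((e.symm q).1 ++ [a]))
      accept := {q | (e.symm q).1 ∈ L} }
  have hd : ∀ w, P.dist w = PMF.pure (f w) := by
    intro w
    induction w using List.reverseRecOn with
    | nil => rfl
    | append_singleton w a ih =>
      have : P.dist (w ++ [a]) = (P.dist w).bind fun p => P.step p a := by
        simp [ProbAutomaton.dist]
      rw [this, ih, PMF.pure_bind]
      simp only [P, f, Equiv.symm_apply_apply]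
      simp only [← lastN_snoc]
  refine ⟨_, Fin k, inferInstance, P, ⟨fun w hw => ?_, fun w hw => ?_⟩, rfl⟩
  · have hw' : f w ∈ P.accept := by
      simp only [P, f, Set.mem_ofPred_eq, Equiv.symm_apply_apply]
      exact hw
    rw [ProbAutomaton.acceptProb, hd, PMF.toOuterMeasure_pure_apply, if_pos hw']
    norm_num
  · have hw' : f w ∈ P.acceptᶜ := by
      simp only [P, f, Set.mem_compl_iff, Set.mem_ofPred_eq, Equiv.symm_apply_apply]
      exact hw
    rw [ProbAutomaton.rejectProb, hd, PMF.toOuterMeasure_pure_apply, if_pos hw']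
    norm_num

/-- The randomized space complexity (two-sided error `1/3`) of `L` in the fixed-size sliding
window model: the least number of bits `log₂ |Q|` over all randomized streaming algorithms for
`SW pad n L`. Algorithms with infinitely many states use infinite space and do not contribute;
one with finitely many states always exists, see `spaceSet_nonempty`. -/
noncomputable def randSpace {α : Type*} (pad : α) (L : Language α) (n : ℕ) : ℝ :=
  sInf {s : ℝ | ∃ (σ : Type) (_ : Finite σ) (P : ProbAutomaton α σ),
    P.IsFor (SW pad n L) (1 / 3) ∧ s = Real.logb 2 (Nat.card σ)}

/-! ### Classes of languages -/

section Classes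

variable (α : Type*)

/-- Regular length languages: each `Σⁿ` is contained in `L` or disjoint from `L`. -/
def Len : Set (Language α) :=
  {L | L.IsRegular ∧
    ∀ n : ℕ, (∀ w : List α, w.length = n → w ∈ L) ∨ (∀ w : List α, w.length = n → w ∉ L)}

/-- Suffix-testable languages: finite Boolean combinations of the languages `Σ* w`. -/
def ST : Set (Language α) :=
  BooleanSubalgebra.closure {L : Language α | ∃ w : List α, L = ⊤ * {w}}

/-- Regular suffix-free languages. -/
def SF : Set (Language α) :=
  {L | L.IsRegular ∧ ∀ x y : List α, x ++ y ∈ L → x ≠ [] → y ∉ L}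

/-- Regular left ideals: the languages `Σ* K` with `K` regular. -/
def LI : Set (Language α) :=
  {L | ∃ K : Language α, K.IsRegular ∧ L = ⊤ * K}

end Classes

/-- All finite Boolean combinations of languages in `C`. -/
def BoolComb {α : Type*} (C : Set (Language α)) : Set (Language α) :=
  BooleanSubalgebra.closure C

/-! ### Asymptotic notation -/

/-- `f = Ω̄(g)`: `f n ≥ c * g n` for some `c > 0` and infinitely many `n`. -/
def OmegaBar (f g : ℕ → ℝ) : Prop :=
  ∃ c : ℝ, 0 < c ∧ ∃ᶠ n in atTop, c * g n ≤ f n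

/-- `f = Θ̄(g)`: `f = O(g)` and `f = Ω̄(g)`. -/
def ThetaBar (f g : ℕ → ℝ) : Prop :=
  f =O[atTop] g ∧ OmegaBar f g

/-- `SW pad n L` is a nontrivial problem: some but not all words of length `n` lie in `L`. -/
def NontrivialAt {α : Type*} (L : Language α) (n : ℕ) : Prop :=
  (∃ u : List α, u.length = n ∧ u ∈ L) ∧ (∃ v : List α, v.length = n ∧ v ∉ L)

/-- `f = Θ(1)` for a space complexity `f` of `L`: `f` is bounded, and it is bounded away from
zero on the window lengths at which the problem is nontrivial. (At every other window length a
single memory state suffices, so the space is `log 1 = 0`.) -/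
def ThetaOne {α : Type*} (L : Language α) (f : ℕ → ℝ) : Prop :=
  f =O[atTop] (fun _ => (1 : ℝ)) ∧ ∃ c : ℝ, 0 < c ∧ ∀ n, NontrivialAt L n → c ≤ f n

/-- `log₂ n`. -/
noncomputable def log2 (n : ℕ) : ℝ := Real.logb 2 n

/-- `log₂ log₂ n`. -/
noncomputable def loglog2 (n : ℕ) : ℝ := Real.logb 2 (Real.logb 2 n)

end SlidingWindow

/-!
Let `M` be an automaton for the reversal of `L`, so that `M` reads the window from its most recent
symbol backwards. The three Boolean closures contain `L` if words of equal length, read from a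
reachable state `p`, agree on acceptance, for (1) all recurrent `p`, (2) recurrent `p` and recurrent
end states, (3) end states in the strongly connected component of `p`.

Languages with cheap algorithms for every positive error probability are closed under Boolean
combinations. For a left ideal it suffices to store, for each state of `M`, the distance to the
shortest hit, capped at the window length. A window lies in a suffix-free language if and only if
this distance is exactly `n`, so it may be stored modulo a random prime of size polylogarithmic
in `n`, provided that it only survives with probability `(1 - ε / n) ^ c` after `c` increments:
a wrong distance then is too large to survive or agrees with `n` modulo few primes.

If one of the conditions fails, then `M` has cycles that can be pumped. For (3) they encode
arbitrary bit strings of which every bit can be queried, which takes linear space. For (2) they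
encode a number of `Ω(log n)` bits that can be compared with arbitrary thresholds, and binary search
recovers every bit. For (1) any two of linearly many numbers are told apart by some query, so the
state distributions that encode them are far apart; with few states there are, up to rounding, too
few such distributions.
-/

namespace SlidingWindow

open Filter Asymptotics

variable {α : Type*}

/-! ### Regular languages -/

theorem isRegular_accepts {σ : Type*} [Finite σ] (M : DFA α σ) : M.accepts.IsRegular :=
  have := Fintype.ofFinite σ
  Language.isRegular_iff.2 ⟨σ, inferInstance, M, rfl⟩

theorem exists_eq_reverse_accepts {L : Language α} (hL : L.IsRegular) :
    ∃ (σ : Type) (_ : Finite σ) (M : DFA α σ), L = M.accepts.reverse := by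
  obtain ⟨σ, _, M, hM⟩ := hL.reverse
  exact ⟨σ, inferInstance, M, by rw [hM, Language.reverse_reverse]⟩

theorem mem_reverse_accepts {σ : Type*} {M : DFA α σ} {w : List α} :
    w ∈ M.accepts.reverse ↔ M.eval w.reverse ∈ M.accept := Iff.rfl

theorem isRegular_of_mem_iff_take_mem [Finite α] (k : ℕ) {K : Language α}
    (h : ∀ w, w ∈ K ↔ w.take k ∈ K) : K.IsRegular := by
  apply Language.IsRegular.of_finite_range_leftQuotient
  refine ((List.finite_length_le α k).image K.leftQuotient).subset ?_
  rintro _ ⟨x, rfl⟩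
  refine ⟨x.take k, List.length_take_le k x, ?_⟩
  ext y
  have htake : (x.take k ++ y).take k = (x ++ y).take k := by
    rw [List.take_append, List.take_append, List.take_take, min_self, List.length_take]
    congr 2
    omega
  rw [Language.mem_leftQuotient, Language.mem_leftQuotient, h, htake, ← h]

/-- The words that have the same length as some word of `K`; these languages supply the elements
of `Len`. -/
def sameLength (K : Language α) : Language α := {w | ∃ u ∈ K, u.length = w.length}

/-- The words whose length is congruent to the residue `r` modulo `m`. -/
def lengthMod (m r : ℕ) : Language α := {w | w.length % m = r}

theorem isRegular_lengthMod {m : ℕ} (r : ℕ) (hm : 0 < m) :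
    (lengthMod m r : Language α).IsRegular := by
  apply Language.IsRegular.of_finite_range_leftQuotient
  refine ((Set.finite_Iio m).image
    fun s => ({w | (s + w.length) % m = r} : Language α)).subset ?_
  rintro _ ⟨x, rfl⟩
  refine ⟨x.length % m, Nat.mod_lt _ hm, ?_⟩
  ext y
  change (x.length % m + y.length) % m = r ↔ (x ++ y).length % m = r
  rw [Nat.mod_add_mod, List.length_append]

/-- The subset automaton of the nondeterministic automaton that ignores the letters read and
guesses the letters fed to `M`. -/
def letterBlind {σ : Type*} (M : DFA α σ) : DFA α (Set σ) where
  step S _ := {q | ∃ p ∈ S, ∃ b, M.step p b = q}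
  start := {M.start}
  accept := {S | ∃ q ∈ S, q ∈ M.accept}

theorem letterBlind_eval {σ : Type*} (M : DFA α σ) (w : List α) :
    (letterBlind M).eval w = {q | ∃ u : List α, u.length = w.length ∧ M.eval u = q} := by
  induction w using List.reverseRecOn with
  | nil => ext q; simp [letterBlind, eq_comm]
  | append_singleton w a ih =>
    rw [DFA.eval_append_singleton, ih]
    ext q
    constructor
    · rintro ⟨p, ⟨u, hu, rfl⟩, b, rfl⟩
      exact ⟨u ++ [b], by simp [hu], M.eval_append_singleton u b⟩
    · rintro ⟨u, hu, rfl⟩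
      rcases List.eq_nil_or_concat' u with rfl | ⟨u, b, rfl⟩
      · simp at hu
      · exact ⟨M.eval u, ⟨u, by simpa using hu, rfl⟩, b, (M.eval_append_singleton u b).symm⟩

theorem letterBlind_accepts {σ : Type*} (M : DFA α σ) :
    (letterBlind M).accepts = sameLength M.accepts := by
  ext w
  rw [DFA.mem_accepts, letterBlind_eval]
  constructor
  · rintro ⟨_, ⟨u, hlen, rfl⟩, hu⟩
    exact ⟨u, hu, hlen⟩
  · rintro ⟨u, hu, hlen⟩
    exact ⟨M.eval u, ⟨u, hlen, rfl⟩, hu⟩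

theorem isRegular_sameLength {K : Language α} (hK : K.IsRegular) :
    (sameLength K).IsRegular := by
  obtain ⟨σ, _, M, rfl⟩ := hK
  exact letterBlind_accepts M ▸ isRegular_accepts (letterBlind M)

/-! ### The four language classes -/

theorem sameLength_mem_Len {K : Language α} (hK : K.IsRegular) : sameLength K ∈ Len α := by
  refine ⟨isRegular_sameLength hK, fun n => ?_⟩
  by_cases h : ∃ u ∈ K, u.length = n
  · obtain ⟨u, hu, rfl⟩ := h
    exact Or.inl fun w hw => ⟨u, hu, hw.symm⟩
  · exact Or.inr fun w hw ⟨u, hu, hlen⟩ => h ⟨u, hu, hlen.trans hw⟩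

theorem lengthMod_mem_Len {m : ℕ} (r : ℕ) (hm : 0 < m) : lengthMod m r ∈ Len α := by
  refine ⟨isRegular_lengthMod r hm, fun n => ?_⟩
  by_cases h : n % m = r
  · exact Or.inl fun w hw => (congrArg (· % m) hw).trans h
  · exact Or.inr fun w hw hr => h ((congrArg (· % m) hw.symm).trans hr)

theorem mem_top_mul_iff {K : Language α} {w : List α} : w ∈ ⊤ * K ↔ ∃ v ∈ K, v <:+ w := by
  rw [Language.mem_mul]
  exact ⟨fun ⟨u, _, v, hv, h⟩ => ⟨v, hv, u, h⟩, fun ⟨v, hv, u, h⟩ => ⟨u, trivial, v, hv, h⟩⟩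

theorem mem_top_mul_reverse_iff {K : Language α} {w : List α} :
    w ∈ ⊤ * K.reverse ↔ ∃ v ∈ K, v <+: w.reverse := by
  rw [mem_top_mul_iff]
  constructor
  · rintro ⟨v, hv, hvw⟩
    exact ⟨v.reverse, hv, List.reverse_prefix.2 hvw⟩
  · rintro ⟨v, hv, hvw⟩
    exact ⟨v.reverse, Language.reverse_mem_reverse.2 hv, by
      rwa [← List.reverse_prefix, List.reverse_reverse]⟩

theorem mem_top_mul_singleton_reverse_iff {v w : List α} :
    w ∈ ⊤ * ({v.reverse} : Language α) ↔ v <+: w.reverse := by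
  rw [mem_top_mul_iff, ← List.reverse_suffix, List.reverse_reverse]
  exact ⟨fun ⟨_, h, hw⟩ => h ▸ hw, fun h => ⟨_, rfl, h⟩⟩

theorem reverse_mem_SF {K : Language α} (hK : K.IsRegular)
    (h : ∀ x y, x ∈ K → y ≠ [] → x ++ y ∉ K) : K.reverse ∈ SF α := by
  refine ⟨hK.reverse, fun x y hxy hx hy => h y.reverse x.reverse hy (by simpa using hx) ?_⟩
  rw [← List.reverse_append]
  exact hxy

theorem mem_boolComb_of_finite_signature {C S : Set (Language α)} (hS : S.Finite) (hSC : S ⊆ C)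
    {L : Language α} (h : ∀ w w', (∀ K ∈ S, w ∈ K ↔ w' ∈ K) → w ∈ L → w' ∈ L) :
    L ∈ BoolComb C := by
  classical
  have : Finite S := hS
  let A := BooleanSubalgebra.closure C
  let signature (w : List α) : Set S := {K | w ∈ K.1}
  let cell (T : Set S) : Language α := ⨅ K : S, if K ∈ T then K.1 else K.1ᶜ
  have cell_mem (T : Set S) : cell T ∈ A := by
    refine A.infClosed.iInf_mem BooleanSubalgebra.top_mem fun K => ?_
    have hK : K.1 ∈ A := BooleanSubalgebra.subset_closure (hSC K.2)
    split_ifs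
    exacts [hK, BooleanSubalgebra.compl_mem hK]
  have mem_cell (T : Set S) (w : List α) : w ∈ cell T ↔ signature w = T := by
    refine Set.mem_iInter.trans ((forall_congr' fun K => ?_).trans Set.ext_iff.symm)
    split_ifs with hK
    exacts [(iff_true_right hK).symm, (iff_false_right hK).symm]
  have hL : L = ⨆ T : signature '' L, cell T := by
    ext w
    rw [Language.mem_iSup]
    constructor
    · exact fun hw => ⟨⟨_, w, hw, rfl⟩, (mem_cell _ w).2 rfl⟩
    · rintro ⟨⟨_, u, hu, rfl⟩, hw⟩
      have hsig := Set.ext_iff.1 ((mem_cell _ w).1 hw).symm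
      exact h u w (fun K hK => hsig ⟨K, hK⟩) hu
  rw [hL]
  exact A.supClosed.iSup_mem BooleanSubalgebra.bot_mem fun T => cell_mem T

/-! ### Cycles of automata -/

/-- The `j`-fold repetition of the word `v`. -/
def rep (v : List α) (j : ℕ) : List α := (List.replicate j v).flatten

theorem rep_one (v : List α) : rep v 1 = v := List.append_nil v

theorem rep_add (v : List α) (i j : ℕ) : rep v (i + j) = rep v i ++ rep v j := by
  rw [rep, rep, rep, ← List.flatten_append, List.replicate_append_replicate]

@[simp] theorem length_rep (v : List α) (j : ℕ) : (rep v j).length = j * v.length := by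
  simp [rep]

theorem rep_prefix_rep (v : List α) {i j : ℕ} (h : i ≤ j) : rep v i <+: rep v j := by
  obtain ⟨e, rfl⟩ := Nat.exists_eq_add_of_le h
  exact ⟨rep v e, (rep_add v i e).symm⟩

theorem rep_append_prefix_rep {v s : List α} (hs : s <+: v) {i j : ℕ} (h : i < j) :
    rep v i ++ s <+: rep v j := by
  refine List.IsPrefix.trans ?_ (rep_prefix_rep v h)
  rw [Nat.succ_eq_add_one, rep_add, rep_one]
  exact (List.prefix_append_right_inj _).2 hs

theorem prefix_rep {v s : List α} (hs : s <+: v) {j : ℕ} (h : 0 < j) : s <+: rep v j :=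
  rep_append_prefix_rep hs h

section Automata

variable {σ : Type*} (M : DFA α σ)

theorem eval_append (u v : List α) : M.eval (u ++ v) = M.evalFrom (M.eval u) v :=
  M.evalFrom_of_append _ u v

theorem evalFrom_rep {M : DFA α σ} {p : σ} {v : List α} (h : M.evalFrom p v = p) (j : ℕ) :
    M.evalFrom p (rep v j) = p :=
  M.evalFrom_of_pow h ⟨_, rfl, fun _ hy => List.eq_of_mem_replicate hy⟩

theorem eval_append_rep_append {M : DFA α σ} {y v : List α}
    (h : M.evalFrom (M.eval y) v = M.eval y) (j : ℕ) (t : List α) :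
    M.eval (y ++ (rep v j ++ t)) = M.evalFrom (M.eval y) t := by
  rw [eval_append, DFA.evalFrom_of_append, evalFrom_rep h]

/-- Some word leads from the state `p` to the state `q`. -/
def Reaches (p q : σ) : Prop := ∃ v, M.evalFrom p v = q

/-- The state `p` lies on a nonempty cycle of `M`. -/
def Recurrent (p : σ) : Prop := ∃ v, v ≠ [] ∧ M.evalFrom p v = p

/-- Words of equal length lead from a reachable state `p` either both to accepting or both to
rejecting states, as far as the states reached are in the relation `R` to `p`. For three choices
of `R`, this property of an automaton reading the window from right to left decides whether the
space complexity is bounded, doubly logarithmic or logarithmic. -/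
def LengthDetermined (R : σ → σ → Prop) : Prop :=
  ∀ y t t' : List α, t.length = t'.length →
    R (M.eval y) (M.evalFrom (M.eval y) t) → R (M.eval y) (M.evalFrom (M.eval y) t') →
    M.evalFrom (M.eval y) t ∈ M.accept → M.evalFrom (M.eval y) t' ∈ M.accept

theorem exists_recurrent_prefix [Finite σ] {w : List α} (hw : Nat.card σ ≤ w.length) :
    ∃ y t, w = y ++ t ∧ Recurrent M (M.eval y) := by
  have := Fintype.ofFinite σ
  rw [Nat.card_eq_fintype_card] at hw
  obtain ⟨q, a, b, c, rfl, -, hb, ha, hq, -⟩ := M.evalFrom_split (s := M.start) hw rfl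
  refine ⟨a, b ++ c, List.append_assoc a b c, b, hb, ?_⟩
  rw [show M.eval a = q from ha, hq]

theorem exists_common_period [Finite σ] :
    ∃ m > 0, ∀ p, Recurrent M p → ∀ l, m ∣ l → ∃ v, v.length = l ∧ M.evalFrom p v = p := by
  classical
  have := Fintype.ofFinite σ
  choose! cycle cycle_ne cycle_eval using fun p (hp : Recurrent M p) => hp
  let period (p : σ) : ℕ := if Recurrent M p then (cycle p).length else 1
  refine ⟨∏ p, period p, Finset.prod_pos fun p _ => ?_, fun p hp l hl => ?_⟩
  · dsimp only [period]
    split_ifs with hp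
    exacts [List.length_pos_iff.2 (cycle_ne p hp), one_pos]
  · have hperiod : period p = (cycle p).length := if_pos hp
    obtain ⟨j, rfl⟩ := (Finset.dvd_prod_of_mem period (Finset.mem_univ p)).trans hl
    exact ⟨rep (cycle p) j, by rw [length_rep, hperiod, mul_comm],
      evalFrom_rep (cycle_eval p hp) j⟩

/-! ### Automata with length-determined acceptance -/

/-- The words accepted by `M` with final states `G` whose prefix of length `k` is `v`. Their
lengths are what a window beginning with `v` is tested for. -/
def evalInWithTake (G : Set σ) (k : ℕ) (v : List α) : Language α :=
  ({ M with accept := G } : DFA α σ).accepts ⊓ {w | w.take k = v}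

theorem isRegular_evalInWithTake [Finite α] [Finite σ] (G : Set σ) (k : ℕ) (v : List α) :
    (evalInWithTake M G k v).IsRegular := by
  refine (isRegular_accepts _).inf (isRegular_of_mem_iff_take_mem k fun w => ?_)
  change w.take k = v ↔ (w.take k).take k = v
  rw [List.take_take, min_self]

theorem sameLength_evalInWithTake_mem_Len [Finite α] [Finite σ] (G : Set σ) (k : ℕ)
    (v : List α) : sameLength (evalInWithTake M G k v) ∈ Len α :=
  sameLength_mem_Len (isRegular_evalInWithTake M G k v)

/-- The tests for the prefixes of length at most `k` of the reversed window, and for the lengths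
of the windows that `M` with final states `G` accepts with a given prefix. -/
def takeTests (G : Set σ) (k : ℕ) : Set (Language α) :=
  (fun v : List α => ⊤ * {v.reverse}) '' {v | v.length ≤ k} ∪
    (fun v => sameLength (evalInWithTake M G k v)) '' {v | v.length ≤ k}

theorem finite_takeTests [Finite α] (G : Set σ) (k : ℕ) : (takeTests M G k).Finite :=
  have hfin := List.finite_length_le α k
  (hfin.image _).union (hfin.image _)

theorem takeTests_subset [Finite α] [Finite σ] (G : Set σ) (k : ℕ) :
    takeTests M G k ⊆ ST α ∪ Len α := by
  rintro _ (⟨v, -, rfl⟩ | ⟨v, -, rfl⟩)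
  · exact Or.inl (BooleanSubalgebra.subset_closure ⟨_, rfl⟩)
  · exact Or.inr (sameLength_evalInWithTake_mem_Len M G k v)

theorem eq_or_exists_recurrent_of_takeTests [Finite σ] {G : Set σ} {w w' : List α}
    (h : ∀ K ∈ takeTests M G (Nat.card σ), w ∈ K ↔ w' ∈ K) (hw : M.eval w.reverse ∈ G) :
    w' = w ∨ ∃ y t t', Recurrent M (M.eval y) ∧ t.length = t'.length ∧
      w'.reverse = y ++ t' ∧ M.evalFrom (M.eval y) t ∈ G := by
  set k := Nat.card σ
  let v := w.reverse.take k
  have hv : v.length ≤ k := List.length_take_le _ _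
  obtain ⟨s', hs'⟩ : v <+: w'.reverse := by
    rw [← mem_top_mul_singleton_reverse_iff, ← h _ (Or.inl ⟨v, hv, rfl⟩),
      mem_top_mul_singleton_reverse_iff]
    exact List.take_prefix _ _
  obtain ⟨u, ⟨huG, huv⟩, hlen⟩ : w' ∈ sameLength (evalInWithTake M G k v) :=
    (h _ (Or.inr ⟨v, hv, rfl⟩)).1 ⟨w.reverse, ⟨hw, rfl⟩, List.length_reverse⟩
  replace huv : u.take k = v := huv
  replace huG : M.eval u ∈ G := huG
  obtain ⟨s, hs⟩ : v <+: u := huv ▸ List.take_prefix k u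
  have hss : s.length = s'.length := by
    have hl := congrArg List.length hs
    have hl' := congrArg List.length hs'
    simp only [List.length_append, List.length_reverse] at hl hl'
    omega
  by_cases hk : k ≤ v.length
  · obtain ⟨y, t, hvt, hy⟩ := exists_recurrent_prefix M hk
    refine Or.inr ⟨y, t ++ s, t ++ s', hy, by simp [hss], by rw [← hs', hvt, List.append_assoc], ?_⟩
    rwa [← eval_append, ← List.append_assoc, ← hvt, hs]
  · have hshort : w.length < k ∧ u.length < k := by
      have hl : v.length = min k w.length := by simp [v]
      have hl' : v.length = min k u.length := by rw [← huv, List.length_take]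
      omega
    have hvw : v = w.reverse := List.take_of_length_le (by simpa using hshort.1.le)
    have hvu : v = u := by rw [← huv, List.take_of_length_le hshort.2.le]
    obtain rfl : s = [] := by simpa [hvu] using hs
    obtain rfl : s' = [] := List.length_eq_zero_iff.1 hss.symm
    exact Or.inl (List.reverse_injective (by rw [← hs', hvw, List.append_nil]))

theorem mem_boolComb_ST_Len_of_lengthDetermined [Finite α] [Finite σ]
    (h : LengthDetermined M fun p _ => Recurrent M p) :
    M.accepts.reverse ∈ BoolComb (ST α ∪ Len α) := by
  refine mem_boolComb_of_finite_signature (finite_takeTests M M.accept (Nat.card σ))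
    (takeTests_subset M _ _) fun w w' hww' hw => ?_
  obtain rfl | ⟨y, t, t', hy, htt, hw', ht⟩ := eq_or_exists_recurrent_of_takeTests M hww' hw
  · exact hw
  · rw [mem_reverse_accepts, hw', eval_append]
    exact h y t t' htt hy hy ht

theorem reverse_accepts_mem_SF_of_not_recurrent [Finite σ] {q : σ} (hq : ¬ Recurrent M q) :
    ({ M with accept := {q} } : DFA α σ).accepts.reverse ∈ SF α := by
  refine reverse_mem_SF (isRegular_accepts _) fun x y hx hy hxy => hq ⟨y, hy, ?_⟩
  replace hx : M.eval x = q := hx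
  replace hxy : M.eval (x ++ y) = q := hxy
  rwa [eval_append, hx] at hxy

theorem mem_boolComb_ST_SF_Len_of_lengthDetermined [Finite α] [Finite σ]
    (h : LengthDetermined M fun p q => Recurrent M p ∧ Recurrent M q) :
    M.accepts.reverse ∈ BoolComb (ST α ∪ SF α ∪ Len α) := by
  let G : Set σ := {q | q ∈ M.accept ∧ Recurrent M q}
  let endsIn (q : σ) : Language α := ({ M with accept := {q} } : DFA α σ).accepts.reverse
  refine mem_boolComb_of_finite_signature (S := takeTests M G (Nat.card σ) ∪
    endsIn '' {q | ¬ Recurrent M q})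
    ((finite_takeTests M G _).union ((Set.toFinite _).image _)) ?_ fun w w' hww' hw => ?_
  · rintro K (hK | ⟨q, hq, rfl⟩)
    · exact (takeTests_subset M G _ hK).imp_left Or.inl
    · exact Or.inl (Or.inr (reverse_accepts_mem_SF_of_not_recurrent M hq))
  have transient_iff {q : σ} (hq : ¬ Recurrent M q) :
      M.eval w.reverse = q ↔ M.eval w'.reverse = q := hww' (endsIn q) (Or.inr ⟨q, hq, rfl⟩)
  rw [mem_reverse_accepts] at hw ⊢
  by_cases hrec : Recurrent M (M.eval w.reverse)
  · have hrec' : Recurrent M (M.eval w'.reverse) := by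
      by_contra hrec'
      exact hrec' ((transient_iff hrec').2 rfl ▸ hrec)
    obtain rfl | ⟨y, t, t', hy, htt, hw', ht, htrec⟩ :=
      eq_or_exists_recurrent_of_takeTests M (fun K hK => hww' K (Or.inl hK)) ⟨hw, hrec⟩
    · exact hw
    · rw [hw', eval_append] at hrec' ⊢
      exact h y t t' htt ⟨hy, htrec⟩ ⟨hy, hrec'⟩ ht
  · rwa [(transient_iff hrec).1 rfl]

/-- The left ideals of the words whose reversal has a prefix leading to `p` with length `r`
modulo `m`, and of those whose reversal has a prefix leading to a state from which `p` is
unreachable, together with the length tests modulo `m`. -/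
def componentTests (m : ℕ) : Set (Language α) :=
  (Set.range fun x : σ × Fin m =>
      ⊤ * (({ M with accept := {x.1} } : DFA α σ).accepts ⊓ lengthMod m x.2).reverse) ∪
    (Set.range fun p : σ =>
      ⊤ * ({ M with accept := {q | ¬ Reaches M q p} } : DFA α σ).accepts.reverse) ∪
    Set.range fun r : Fin m => lengthMod m r

theorem componentTests_subset [Finite σ] {m : ℕ} (hm : 0 < m) :
    componentTests M m ⊆ LI α ∪ Len α := by
  rintro _ ((⟨x, rfl⟩ | ⟨p, rfl⟩) | ⟨r, rfl⟩)
  · exact Or.inl ⟨_, ((isRegular_accepts _).inf (isRegular_lengthMod _ hm)).reverse, rfl⟩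
  · exact Or.inl ⟨_, (isRegular_accepts _).reverse, rfl⟩
  · exact Or.inr (lengthMod_mem_Len _ hm)

theorem exists_reaches_of_componentTests {m : ℕ} (hm : 0 < m) {w w' : List α}
    (h : ∀ K ∈ componentTests M m, w ∈ K ↔ w' ∈ K) :
    ∃ y t, w'.reverse = y ++ t ∧ M.eval y = M.eval w.reverse ∧
      Reaches M (M.eval w'.reverse) (M.eval y) ∧ m ∣ t.length := by
  set p := M.eval w.reverse
  let r : Fin m := ⟨w.length % m, Nat.mod_lt _ hm⟩
  have hlen : w'.length % m = w.length % m := (h _ (Or.inr ⟨r, rfl⟩)).1 rfl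
  obtain ⟨y, ⟨hy, hyr⟩, t, ht⟩ :=
    mem_top_mul_reverse_iff.1 <| (h _ (Or.inl (Or.inl ⟨(p, r), rfl⟩))).1 <|
      mem_top_mul_reverse_iff.2 ⟨w.reverse, ⟨rfl, congrArg (· % m) List.length_reverse⟩,
        List.prefix_rfl⟩
  replace hy : M.eval y = p := hy
  replace hyr : y.length % m = w.length % m := hyr
  refine ⟨y, t, ht.symm, hy, ?_, ?_⟩
  · by_contra hreach
    rw [hy] at hreach
    obtain ⟨u, hu, c, hc⟩ := mem_top_mul_reverse_iff.1 <| (h _ (Or.inl (Or.inr ⟨p, rfl⟩))).2 <|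
      mem_top_mul_reverse_iff.2 ⟨w'.reverse, hreach, List.prefix_rfl⟩
    replace hu : ¬ Reaches M (M.eval u) p := hu
    exact hu ⟨c, by rw [← eval_append M u c, hc]⟩
  · have hlen_t : y.length + t.length = w'.length := by
      simpa using congrArg List.length ht
    have hmod : y.length + t.length ≡ y.length + 0 [MOD m] := by
      rw [hlen_t]
      exact hlen.trans hyr.symm
    exact (Nat.modEq_zero_iff_dvd).1 (Nat.ModEq.add_left_cancel' _ hmod)

theorem mem_boolComb_LI_Len_of_lengthDetermined [Finite σ]
    (h : LengthDetermined M fun p q => Reaches M q p) :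
    M.accepts.reverse ∈ BoolComb (LI α ∪ Len α) := by
  obtain ⟨m, hm, cycle_of_dvd⟩ := exists_common_period M
  refine mem_boolComb_of_finite_signature (S := componentTests M m)
    (((Set.finite_range _).union (Set.finite_range _)).union (Set.finite_range _))
    (componentTests_subset M hm) fun w w' hww' hw => ?_
  obtain ⟨y, t, hw', hy, ⟨e, he⟩, hmt⟩ := exists_reaches_of_componentTests M hm hww'
  rw [mem_reverse_accepts] at hw ⊢
  rw [← hy] at hw
  rw [hw', eval_append] at he ⊢
  rcases eq_or_ne t [] with rfl | ht
  · exact hw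
  have hrec : Recurrent M (M.eval y) := ⟨t ++ e, by simp [ht], by rw [DFA.evalFrom_of_append, he]⟩
  obtain ⟨u, hlen, hu⟩ := cycle_of_dvd _ hrec _ hmt
  exact h y u t hlen ⟨[], hu⟩ ⟨e, he⟩ (by rwa [hu])

end Automata

/-! ### Acceptance probabilities -/

theorem toOuterMeasure_add_compl {σ : Type*} (p : PMF σ) (s : Set σ) :
    p.toOuterMeasure s + p.toOuterMeasure sᶜ = 1 := by
  rw [PMF.toOuterMeasure_apply, PMF.toOuterMeasure_apply, ← ENNReal.tsum_add, ← p.tsum_coe]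
  exact tsum_congr fun a => congrFun (Set.indicator_self_add_compl s p) a

theorem toOuterMeasure_ne_top {σ : Type*} (p : PMF σ) (s : Set σ) : p.toOuterMeasure s ≠ ⊤ :=
  ne_top_of_le_ne_top ENNReal.one_ne_top
    (le_self_add.trans (toOuterMeasure_add_compl p s).le)

namespace ProbAutomaton

variable {σ : Type*}

theorem nonempty_state (P : ProbAutomaton α σ) : Nonempty σ := ⟨P.init.support_nonempty.some⟩

theorem dist_append (P : ProbAutomaton α σ) (x y : List α) :
    P.dist (x ++ y) =
      (P.dist x).bind fun q => ({ P with init := PMF.pure q } : ProbAutomaton α σ).dist y := by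
  induction y using List.reverseRecOn with
  | nil => simp [dist]
  | append_singleton y a ih =>
    simp only [dist, List.foldl_append, List.foldl_cons, List.foldl_nil] at ih ⊢
    rw [ih, PMF.bind_bind]

theorem dist_snoc (P : ProbAutomaton α σ) (x : List α) (a : α) :
    P.dist (x ++ [a]) = (P.dist x).bind fun q => P.step q a := by
  simp [dist]

theorem acceptProb_nonneg (P : ProbAutomaton α σ) (w : List α) : 0 ≤ P.acceptProb w :=
  ENNReal.toReal_nonneg

theorem acceptProb_add_rejectProb (P : ProbAutomaton α σ) (w : List α) :
    P.acceptProb w + P.rejectProb w = 1 := by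
  rw [acceptProb, rejectProb, ← ENNReal.toReal_add (toOuterMeasure_ne_top _ _)
    (toOuterMeasure_ne_top _ _), toOuterMeasure_add_compl, ENNReal.toReal_one]

theorem acceptProb_le_one (P : ProbAutomaton α σ) (w : List α) : P.acceptProb w ≤ 1 := by
  have h : 0 ≤ P.rejectProb w := ENNReal.toReal_nonneg
  linarith [P.acceptProb_add_rejectProb w]

theorem isFor_iff (P : ProbAutomaton α σ) (K : Language α) (ε : ℝ) :
    P.IsFor K ε ↔ (∀ w ∈ K, 1 - ε ≤ P.acceptProb w) ∧ ∀ w ∉ K, P.acceptProb w ≤ ε := by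
  refine and_congr_right fun _ => forall₂_congr fun w _ => ?_
  have := P.acceptProb_add_rejectProb w
  constructor <;> intro h <;> linarith

/-- The acceptance probability of `y` when `P` is started in the state `q`. -/
noncomputable def acceptFrom (P : ProbAutomaton α σ) (y : List α) (q : σ) : ℝ :=
  ({ P with init := PMF.pure q } : ProbAutomaton α σ).acceptProb y

theorem acceptFrom_nonneg (P : ProbAutomaton α σ) (y : List α) (q : σ) : 0 ≤ P.acceptFrom y q :=
  acceptProb_nonneg _ _

theorem acceptFrom_le_one (P : ProbAutomaton α σ) (y : List α) (q : σ) : P.acceptFrom y q ≤ 1 :=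
  acceptProb_le_one _ _

theorem acceptProb_append [Fintype σ] (P : ProbAutomaton α σ) (x y : List α) :
    P.acceptProb (x ++ y) = ∑ q, (P.dist x q).toReal * P.acceptFrom y q := by
  rw [acceptProb, dist_append, PMF.toOuterMeasure_bind_apply, tsum_fintype,
    ENNReal.toReal_sum fun q _ => ENNReal.mul_ne_top (PMF.apply_ne_top _ _)
      (toOuterMeasure_ne_top _ _)]
  exact Finset.sum_congr rfl fun q _ => ENNReal.toReal_mul

theorem sum_dist [Fintype σ] (P : ProbAutomaton α σ) (x : List α) :
    ∑ q, (P.dist x q).toReal = 1 := by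
  rw [← ENNReal.toReal_sum fun q _ => PMF.apply_ne_top _ _, ← tsum_fintype (L := .unconditional _),
    PMF.tsum_coe, ENNReal.toReal_one]

theorem toReal_dist_le_one (P : ProbAutomaton α σ) (x : List α) (q : σ) :
    (P.dist x q).toReal ≤ 1 :=
  ENNReal.toReal_mono ENNReal.one_ne_top (PMF.coe_le_one _ _)

end ProbAutomaton

/-! ### Communication lower bounds -/

/-- The sum of `f` over all bit strings of length `k`. -/
def bitSum : ℕ → (List Bool → ℝ) → ℝ
  | 0, f => f []
  | k + 1, f => bitSum k (fun r => f (true :: r)) + bitSum k (fun r => f (false :: r))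

theorem bitSum_mono {k : ℕ} {f g : List Bool → ℝ} (h : ∀ r, r.length = k → f r ≤ g r) :
    bitSum k f ≤ bitSum k g := by
  induction k generalizing f g with
  | zero => exact h [] rfl
  | succ k ih =>
    exact add_le_add (ih fun r hr => h _ (by simp [hr])) (ih fun r hr => h _ (by simp [hr]))

theorem bitSum_const (k : ℕ) (c : ℝ) : bitSum k (fun _ => c) = 2 ^ k * c := by
  induction k with
  | zero => simp [bitSum]
  | succ k ih => simp only [bitSum, ih]; ring

theorem bitSum_mul (k : ℕ) (c : ℝ) (f : List Bool → ℝ) :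
    bitSum k (fun r => c * f r) = c * bitSum k f := by
  induction k generalizing f with
  | zero => rfl
  | succ k ih => simp only [bitSum, ih]; ring

theorem bitSum_sum {ι : Type*} (s : Finset ι) (k : ℕ) (f : ι → List Bool → ℝ) :
    bitSum k (fun r => ∑ i ∈ s, f i r) = ∑ i ∈ s, bitSum k (f i) := by
  induction k generalizing f with
  | zero => rfl
  | succ k ih => simp only [bitSum, ih, Finset.sum_add_distrib]

/-- The probability that a guess which is `d` with probability `p`, and `!d` otherwise, hits the
bit `c`. -/
def guessProb (d : Bool) (p : ℝ) (c : Bool) : ℝ := if c = d then p else 1 - p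

theorem guessProb_nonneg {p : ℝ} (h0 : 0 ≤ p) (h1 : p ≤ 1) (d c : Bool) :
    0 ≤ guessProb d p c := by
  unfold guessProb
  split_ifs <;> linarith

theorem guessProb_le_one {p : ℝ} (h0 : 0 ≤ p) (h1 : p ≤ 1) (d c : Bool) :
    guessProb d p c ≤ 1 := by
  unfold guessProb
  split_ifs <;> linarith

theorem guessProb_true_add_guessProb_false (d : Bool) (p : ℝ) :
    guessProb d p true + guessProb d p false = 1 := by
  cases d <;> simp [guessProb]

theorem two_rpow_le_one_add {x : ℝ} (h0 : 0 ≤ x) (h1 : x ≤ 1) : (2 : ℝ) ^ x ≤ 1 + x := by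
  simpa [one_add_one_eq_two] using
    rpow_one_add_le_one_add_mul_self (s := 1) (by norm_num) h0 h1

section Predictor

variable (d : Bool) (g : List Bool → ℝ)

/-- The expected number of correct guesses on the bits `r`, read after the bits `pre`, of a
predictor that guesses the next bit to be `d` with probability `g b` after having read `b`. -/
def guessScore : List Bool → List Bool → ℝ
  | _, [] => 0
  | pre, c :: r => guessProb d (g pre) c + guessScore (pre ++ [c]) r

/-- A multiplicative potential dominating `2 ^ guessScore`, whose sum over all bit strings does
not depend on the predictor. -/
def guessWeight : List Bool → List Bool → ℝ
  | _, [] => 1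
  | pre, c :: r => (1 + guessProb d (g pre) c) * guessWeight (pre ++ [c]) r

theorem bitSum_guessWeight (k : ℕ) (pre : List Bool) :
    bitSum k (guessWeight d g pre) = 3 ^ k := by
  induction k generalizing pre with
  | zero => rfl
  | succ k ih =>
    simp only [bitSum, guessWeight, bitSum_mul, ih]
    linear_combination 3 ^ k * guessProb_true_add_guessProb_false d (g pre)

theorem two_rpow_guessScore_le (h0 : ∀ b, 0 ≤ g b) (h1 : ∀ b, g b ≤ 1) (pre r : List Bool) :
    (2 : ℝ) ^ guessScore d g pre r ≤ guessWeight d g pre r := by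
  induction r generalizing pre with
  | nil => simp [guessScore, guessWeight]
  | cons c r ih =>
    have hnonneg := guessProb_nonneg (h0 pre) (h1 pre) d c
    rw [guessScore, guessWeight, Real.rpow_add two_pos]
    exact mul_le_mul (two_rpow_le_one_add hnonneg (guessProb_le_one (h0 pre) (h1 pre) d c)) (ih _)
      (by positivity) (by linarith)

end Predictor

section AugmentedIndex

variable {σ : Type*} [Fintype σ] {P : ProbAutomaton α σ} {K : Language α} {ε : ℝ}

theorem le_sum_dist_mul_guessProb (hP : P.IsFor K ε) {d c : Bool} {x y : List α}
    (h : x ++ y ∈ K ↔ c = d) :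
    1 - ε ≤ ∑ q, (P.dist x q).toReal * guessProb d (P.acceptFrom y q) c := by
  rw [P.isFor_iff] at hP
  unfold guessProb
  by_cases hc : c = d
  · simp only [if_pos hc, ← P.acceptProb_append]
    exact hP.1 _ (h.2 hc)
  · simp only [if_neg hc, mul_sub, mul_one, Finset.sum_sub_distrib, P.sum_dist,
      ← P.acceptProb_append]
    linarith [hP.2 _ (mt h.1 hc)]

theorem le_sum_dist_mul_guessScore (hP : P.IsFor K ε) (d : Bool) (x y : List Bool → List α)
    {a : List Bool} (h : ∀ b c r, a = b ++ c :: r → (x a ++ y b ∈ K ↔ c = d))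
    {pre r : List Bool} (ha : a = pre ++ r) :
    (1 - ε) * r.length ≤
      ∑ q, (P.dist (x a) q).toReal * guessScore d (fun b => P.acceptFrom (y b) q) pre r := by
  induction r generalizing pre with
  | nil => simp [guessScore]
  | cons c r ih =>
    have hfirst := le_sum_dist_mul_guessProb hP (h pre c r ha)
    have hrest := ih (pre := pre ++ [c]) (by simp [ha])
    simp only [guessScore, mul_add, Finset.sum_add_distrib, List.length_cons, Nat.cast_add,
      Nat.cast_one]
    linarith

theorem two_rpow_le_sum_guessWeight (hP : P.IsFor K ε) (d : Bool) (x y : List Bool → List α)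
    {a : List Bool} (h : ∀ b c r, a = b ++ c :: r → (x a ++ y b ∈ K ↔ c = d)) :
    (2 : ℝ) ^ ((1 - ε) * a.length) ≤
      ∑ q, guessWeight d (fun b => P.acceptFrom (y b) q) [] a := by
  have := P.nonempty_state
  let score (q : σ) : ℝ := guessScore d (fun b => P.acceptFrom (y b) q) [] a
  obtain ⟨q, hq⟩ := Finite.exists_max score
  have hscore : (1 - ε) * a.length ≤ score q :=
    calc (1 - ε) * a.length ≤ ∑ q', (P.dist (x a) q').toReal * score q' :=
          le_sum_dist_mul_guessScore hP d x y h rfl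
      _ ≤ ∑ q', (P.dist (x a) q').toReal * score q :=
          Finset.sum_le_sum fun q' _ => mul_le_mul_of_nonneg_left (hq q') ENNReal.toReal_nonneg
      _ = score q := by rw [← Finset.sum_mul, P.sum_dist, one_mul]
  have hweight (q : σ) : (2 : ℝ) ^ score q ≤ _ := two_rpow_guessScore_le d _
    (fun b => P.acceptFrom_nonneg (y b) q) (fun b => P.acceptFrom_le_one (y b) q) [] a
  calc (2 : ℝ) ^ ((1 - ε) * a.length) ≤ (2 : ℝ) ^ score q :=
        Real.rpow_le_rpow_of_exponent_le one_le_two hscore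
    _ ≤ guessWeight d (fun b => P.acceptFrom (y b) q) [] a := hweight q
    _ ≤ _ := Finset.single_le_sum (f := fun q => guessWeight d (fun b => P.acceptFrom (y b) q) [] a)
        (fun q _ => (Real.rpow_nonneg two_pos.le _).trans (hweight q)) (Finset.mem_univ q)

theorem two_pow_mul_two_rpow_le_card_mul (hP : P.IsFor K ε) (k : ℕ) (d : Bool)
    (x y : List Bool → List α)
    (h : ∀ b c r, b.length + 1 + r.length = k → (x (b ++ c :: r) ++ y b ∈ K ↔ c = d)) :
    (2 : ℝ) ^ k * (2 : ℝ) ^ ((1 - ε) * k) ≤ Fintype.card σ * 3 ^ k := by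
  have hweight : ∀ a : List Bool, a.length = k → (2 : ℝ) ^ ((1 - ε) * k) ≤
      ∑ q, guessWeight d (fun b => P.acceptFrom (y b) q) [] a := by
    rintro a rfl
    refine two_rpow_le_sum_guessWeight hP d x y ?_
    rintro b c r rfl
    exact h b c r (by simp; omega)
  have := bitSum_mono hweight
  rw [bitSum_const, bitSum_sum] at this
  simpa [bitSum_guessWeight] using this

end AugmentedIndex

theorem logb_two_three_le : Real.logb 2 3 ≤ 8 / 5 := by
  have h := Real.logb_le_logb_of_le one_lt_two (by norm_num)
    (show (3 : ℝ) ^ 5 ≤ 2 ^ 8 by norm_num)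
  rw [Real.logb_pow, Real.logb_pow, Real.logb_self_eq_one one_lt_two] at h
  push_cast at h
  linarith

/-- In communication terms, `x a` encodes a bit string `a` of length `k`, and the query `y b` asks
for the bit of `a` that follows the proper prefix `b`. -/
theorem le_logb_card_of_augmentedIndex {σ : Type*} [Finite σ] {P : ProbAutomaton α σ}
    {K : Language α} (hP : P.IsFor K (1 / 3)) (k : ℕ) (d : Bool) (x y : List Bool → List α)
    (h : ∀ b c r, b.length + 1 + r.length = k → (x (b ++ c :: r) ++ y b ∈ K ↔ c = d)) :
    (k : ℝ) / 15 ≤ Real.logb 2 (Nat.card σ) := by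
  have := Fintype.ofFinite σ
  have := P.nonempty_state
  have hcount := two_pow_mul_two_rpow_le_card_mul hP k d x y h
  have hcard : (Fintype.card σ : ℝ) ≠ 0 := by exact_mod_cast Fintype.card_ne_zero
  have hlog := Real.logb_le_logb_of_le one_lt_two (by positivity) hcount
  rw [Real.logb_mul hcard (by positivity), Real.logb_mul (by positivity) (by positivity),
    Real.logb_pow, Real.logb_pow, Real.logb_rpow two_pos (by norm_num),
    Real.logb_self_eq_one one_lt_two] at hlog
  rw [Nat.card_eq_fintype_card]
  linarith [mul_le_mul_of_nonneg_left logb_two_three_le (Nat.cast_nonneg (α := ℝ) k)]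

/-- The value of a bit string, most significant bit first. -/
def bitVal : List Bool → ℕ
  | [] => 0
  | c :: r => (if c then 2 ^ r.length else 0) + bitVal r

theorem bitVal_lt (r : List Bool) : bitVal r < 2 ^ r.length := by
  induction r with
  | nil => simp [bitVal]
  | cons c r ih =>
    simp only [bitVal, List.length_cons, pow_succ]
    split_ifs <;> omega

theorem bitVal_append (b r : List Bool) :
    bitVal (b ++ r) = bitVal b * 2 ^ r.length + bitVal r := by
  induction b with
  | nil => simp [bitVal]
  | cons c b ih =>
    simp only [bitVal, List.cons_append, ih, List.length_append, pow_add]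
    split_ifs <;> ring

theorem midpoint_le_bitVal_iff (b r : List Bool) (c : Bool) :
    bitVal b * 2 ^ (r.length + 1) + 2 ^ r.length ≤ bitVal (b ++ c :: r) ↔ c = true := by
  have hr := bitVal_lt r
  rw [bitVal_append, List.length_cons]
  cases c <;> simp [bitVal, hr]

/-- The bit of `a` that follows a prefix `b` is found by comparing `a` with the midpoint of the
interval of the numbers whose binary expansions begin with `b`. -/
theorem le_logb_card_of_greaterThan {σ : Type*} [Finite σ] {P : ProbAutomaton α σ}
    {K : Language α} (hP : P.IsFor K (1 / 3)) (k : ℕ) (d : Bool) (x y : ℕ → List α)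
    (h : ∀ i θ, i < 2 ^ k → θ ≤ 2 ^ k → (x i ++ y θ ∈ K ↔ (θ ≤ i ↔ d = true))) :
    (k : ℝ) / 15 ≤ Real.logb 2 (Nat.card σ) := by
  refine le_logb_card_of_augmentedIndex hP k d (fun a => x (bitVal a))
    (fun b => y (bitVal b * 2 ^ (k - b.length) + 2 ^ (k - b.length - 1))) fun b c r hk => ?_
  obtain ⟨hpred, hsub⟩ : k - b.length - 1 = r.length ∧ k - b.length = r.length + 1 := by omega
  have hval (c : Bool) : bitVal (b ++ c :: r) < 2 ^ k := by
    rw [← hk, add_assoc, add_comm 1]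
    simpa using bitVal_lt (b ++ c :: r)
  have hmid := ((midpoint_le_bitVal_iff b r true).2 rfl).trans (hval true).le
  rw [hpred, hsub, h _ _ (hval c) hmid, midpoint_le_bitVal_iff]
  cases c <;> cases d <;> decide

section Distinguishing

variable {σ : Type*} [Fintype σ] (P : ProbAutomaton α σ)

/-- The distribution of `P` after reading `x`, rounded down to multiples of `1 / m`. -/
noncomputable def roundedDist (m : ℕ) (x : List α) (q : σ) : Fin (m + 1) :=
  ⟨⌊m * (P.dist x q).toReal⌋₊, Nat.lt_succ_of_le <| Nat.floor_le_of_le <|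
    mul_le_of_le_one_right m.cast_nonneg (P.toReal_dist_le_one x q)⟩

theorem acceptProb_append_le_of_roundedDist_eq {m : ℕ} (hm : 0 < m) {x x' : List α}
    (h : roundedDist P m x = roundedDist P m x') (y : List α) :
    P.acceptProb (x ++ y) ≤ P.acceptProb (x' ++ y) + Fintype.card σ / m := by
  have hm' : (0 : ℝ) < m := by exact_mod_cast hm
  have hdist (q : σ) : (P.dist x q).toReal ≤ (P.dist x' q).toReal + 1 / m := by
    have hfloor : ⌊m * (P.dist x q).toReal⌋₊ = ⌊m * (P.dist x' q).toReal⌋₊ :=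
      congrArg Fin.val (congrFun h q)
    have hlt := Nat.lt_floor_add_one (m * (P.dist x q).toReal)
    have hle := Nat.floor_le (show 0 ≤ m * (P.dist x' q).toReal by positivity)
    rw [hfloor] at hlt
    rw [← sub_le_iff_le_add', le_div_iff₀ hm']
    linarith
  rw [P.acceptProb_append, P.acceptProb_append]
  calc ∑ q, (P.dist x q).toReal * P.acceptFrom y q
      ≤ ∑ q, ((P.dist x' q).toReal * P.acceptFrom y q + 1 / m) := by
        refine Finset.sum_le_sum fun q _ => ?_
        have hmul := mul_le_mul_of_nonneg_right (hdist q) (P.acceptFrom_nonneg y q)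
        have hone : 1 / (m : ℝ) * P.acceptFrom y q ≤ 1 / m :=
          mul_le_of_le_one_right (by positivity) (P.acceptFrom_le_one y q)
        linarith
    _ = _ := by
        rw [Finset.sum_add_distrib, Finset.sum_const, Finset.card_univ, nsmul_eq_mul, mul_one_div]

end Distinguishing

theorem card_le_of_distinguishable {σ : Type*} [Finite σ] {P : ProbAutomaton α σ}
    {K : Language α} (hP : P.IsFor K (1 / 3)) (N : ℕ) (x : ℕ → List α)
    (h : ∀ i j, i < j → j < N → ∃ y, ¬ (x i ++ y ∈ K ↔ x j ++ y ∈ K)) :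
    N ≤ (6 * Nat.card σ + 1) ^ Nat.card σ := by
  have := Fintype.ofFinite σ
  have := P.nonempty_state
  rw [P.isFor_iff] at hP
  set m := Nat.card σ with hm
  have hclose {u v : List α} (huv : roundedDist P (6 * m) u = roundedDist P (6 * m) v)
      (y : List α) : P.acceptProb (u ++ y) ≤ P.acceptProb (v ++ y) + 1 / 6 := by
    have hm0 : 0 < m := Nat.card_pos
    convert acceptProb_append_le_of_roundedDist_eq P (by positivity : 0 < 6 * m) huv y using 2
    rw [← Nat.card_eq_fintype_card, ← hm]
    push_cast
    field_simp
  have hne : ∀ i j, i < j → j < N → roundedDist P (6 * m) (x i) ≠ roundedDist P (6 * m) (x j) := by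
    intro i j hij hj heq
    obtain ⟨y, hy⟩ := h i j hij hj
    have hiff := (not_iff.1 hy).symm
    by_cases hjK : x j ++ y ∈ K
    · linarith [hP.1 _ hjK, hP.2 _ (hiff.1 hjK), hclose heq.symm y]
    · linarith [hP.2 _ hjK, hP.1 _ (not_not.1 (mt hiff.2 hjK)), hclose heq y]
  have hinj : Function.Injective fun i : Fin N => roundedDist P (6 * m) (x i) := by
    intro i j hij
    by_contra hne_ij
    rcases lt_or_gt_of_ne hne_ij with hlt | hlt
    exacts [hne i j hlt j.2 hij, hne j i hlt i.2 hij.symm]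
  have := Nat.card_le_card_of_injective _ hinj
  rwa [Nat.card_fun, Nat.card_fin, Nat.card_fin, ← hm] at this

/-! ### Lower bounds on the space complexity -/

theorem le_randSpace [Finite α] {pad : α} {L : Language α} {n : ℕ} {s : ℝ}
    (h : ∀ (σ : Type) (_ : Finite σ) (P : ProbAutomaton α σ), P.IsFor (SW pad n L) (1 / 3) →
      s ≤ Real.logb 2 (Nat.card σ)) : s ≤ randSpace pad L n := by
  refine le_csInf (spaceSet_nonempty pad L n) ?_
  rintro _ ⟨σ, hσ, P, hP, rfl⟩
  exact h σ hσ P hP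

theorem lastN_of_le {pad : α} {n : ℕ} {x : List α} (h : n ≤ x.length) :
    lastN pad n x = x.rtake n := by
  simp [lastN, Nat.sub_eq_zero_of_le h]

theorem omegaBar_of_eventually_le {f g : ℕ → ℝ} {b C : ℝ} (hb : 0 < b) (hC : 0 < C) (ν : ℕ → ℕ)
    (hν : ∀ k, k ≤ ν k) (hg : ∀ᶠ k : ℕ in atTop, g (ν k) ≤ C * k)
    (hf : ∀ᶠ k : ℕ in atTop, b * k ≤ f (ν k)) : OmegaBar f g := by
  refine ⟨b / C, by positivity, (tendsto_atTop_mono hν tendsto_id).frequently ?_⟩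
  refine (hg.and hf).frequently.mono fun k ⟨hgk, hfk⟩ => ?_
  calc b / C * g (ν k) ≤ b / C * (C * k) := by gcongr
    _ = b * k := by field_simp
    _ ≤ f (ν k) := hfk

theorem log2_le {n D k : ℕ} (hn : 0 < n) (h : n ≤ D * 2 ^ k) : log2 n ≤ Real.logb 2 D + k := by
  have hD : (0 : ℝ) < D := by exact_mod_cast Nat.pos_of_mul_pos_right (hn.trans_le h)
  have hlog := Real.logb_le_logb_of_le one_lt_two (by exact_mod_cast hn)
    (by exact_mod_cast h : (n : ℝ) ≤ D * 2 ^ k)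
  rwa [Real.logb_mul (by positivity) (by positivity), Real.logb_pow,
    Real.logb_self_eq_one one_lt_two, mul_one] at hlog

theorem one_le_log2 {n : ℕ} (hn : 2 ≤ n) : 1 ≤ log2 n := by
  rw [log2, Real.le_logb_iff_rpow_le one_lt_two (by positivity), Real.rpow_one]
  exact_mod_cast hn

theorem loglog2_le {n D k : ℕ} (hn : 2 ≤ n) (h : n ≤ D * 2 ^ 2 ^ k) :
    loglog2 n ≤ Real.logb 2 (Real.logb 2 D + 1) + k := by
  have hn0 : 0 < n := by omega
  have hD : (1 : ℝ) ≤ D := by exact_mod_cast Nat.pos_of_mul_pos_right (hn0.trans_le h)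
  have hlogD : 0 ≤ Real.logb 2 D := Real.logb_nonneg one_lt_two hD
  have hlog : log2 n ≤ (Real.logb 2 D + 1) * 2 ^ k := by
    have hle := log2_le (by omega) h
    have hpow : (1 : ℝ) ≤ 2 ^ k := one_le_pow₀ one_le_two
    push_cast at hle
    nlinarith
  have hloglog := Real.logb_le_logb_of_le one_lt_two (by linarith [one_le_log2 hn]) hlog
  rwa [Real.logb_mul (by positivity) (by positivity), Real.logb_pow,
    Real.logb_self_eq_one one_lt_two, mul_one] at hloglog

theorem add_mul_add_le_mul (a c e : ℕ) {m : ℕ} (hm : 1 ≤ m) : a + m * c + e ≤ (a + c + e) * m := by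
  nlinarith

section Streams

variable {σ : Type*} {M : DFA α σ} {p : σ}

theorem reverse_append_reverse_mem_SW {pad : α} {n : ℕ} {x y w : List α} (hn : w.length = n)
    (h : w <+: y ++ x) :
    x.reverse ++ y.reverse ∈ SW pad n M.accepts.reverse ↔ M.eval w ∈ M.accept := by
  change lastN pad n _ ∈ M.accepts.reverse ↔ _
  rw [← List.reverse_append, lastN_of_le (by rw [← hn, List.length_reverse]; exact h.length_le),
    List.rtake_eq_reverse_take_reverse, List.reverse_reverse, ← hn, ← List.prefix_iff_eq_take.1 h,
    mem_reverse_accepts, List.reverse_reverse]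

theorem evalFrom_flatMap {β : Type*} {block : β → List α} (h : ∀ c, M.evalFrom p (block c) = p)
    (a : List β) : M.evalFrom p (a.flatMap block) = p := by
  induction a with
  | nil => rfl
  | cons c a ih => rw [List.flatMap_cons, DFA.evalFrom_of_append, h, ih]

/-! #### Linear space -/

theorem exists_cycles_of_reaches {t : Bool → List α} (hlen : (t true).length = (t false).length)
    (hpos : 0 < (t true).length) (h : ∀ c, Reaches M (M.evalFrom p (t c)) p) :
    ∃ (l : ℕ) (block : Bool → List α), ∀ c,
      (block c).length = l ∧ t c <+: block c ∧ M.evalFrom p (block c) = p := by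
  choose ret hret using h
  let cyc (c : Bool) : List α := t c ++ ret c
  have hcyc (c : Bool) : M.evalFrom p (cyc c) = p := by rw [DFA.evalFrom_of_append, hret]
  have hcyc_pos (c : Bool) : 0 < (cyc c).length := by
    cases c <;> simp only [cyc, List.length_append] <;> omega
  refine ⟨(cyc true).length * (cyc false).length, fun c => rep (cyc c) (cyc !c).length,
    fun c => ⟨?_, prefix_rep (List.prefix_append _ _) (hcyc_pos _), evalFrom_rep (hcyc c) _⟩⟩
  cases c
  · exact length_rep _ _
  · exact (length_rep _ _).trans (mul_comm _ _)

theorem blockCode_mem_SW {pad : α} {y : List α} {t block : Bool → List α} {m l k : ℕ}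
    (ht : ∀ c, (t c).length = m)
    (hblock : ∀ c, (block c).length = l ∧ t c <+: block c ∧
      M.evalFrom (M.eval y) (block c) = M.eval y)
    (b : List Bool) (c : Bool) (r : List Bool) (hk : b.length + 1 + r.length = k) :
    ((b ++ c :: r).flatMap block).reverse ++ (y ++ rep (block true) (k - b.length)).reverse ∈
      SW pad (y.length + k * l + m) M.accepts.reverse ↔
        M.evalFrom (M.eval y) (t c) ∈ M.accept := by
  have hlen : (k - b.length) * l + b.length * l = k * l := by
    rw [← add_mul, Nat.sub_add_cancel (by omega)]
  rw [reverse_append_reverse_mem_SW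
    (w := y ++ (rep (block true) (k - b.length) ++ (b.flatMap block ++ t c)))]
  · rw [eval_append_rep_append (hblock true).2.2, DFA.evalFrom_of_append,
      evalFrom_flatMap fun c => (hblock c).2.2]
  · simp only [List.length_append, length_rep, List.length_flatMap, hblock, ht, List.map_const',
      List.sum_replicate, smul_eq_mul]
    omega
  · simp only [List.flatMap_append, List.flatMap_cons, List.append_assoc,
      List.prefix_append_right_inj]
    exact (hblock c).2.1.trans (List.prefix_append _ _)

theorem omegaBar_linear_of_not_lengthDetermined [Finite α] (pad : α)
    (h : ¬ LengthDetermined M fun p q => Reaches M q p) :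
    OmegaBar (randSpace pad M.accepts.reverse) fun n => (n : ℝ) := by
  simp only [LengthDetermined, not_forall] at h
  obtain ⟨y, u, v, huv, hu, hv, hua, hva⟩ := h
  let t (c : Bool) : List α := if c then u else v
  have ht (c : Bool) : (t c).length = u.length := by cases c <;> simp [t, huv]
  have hpos : 0 < u.length := by
    rw [List.length_pos_iff]
    rintro rfl
    obtain rfl := List.length_eq_zero_iff.1 huv.symm
    exact hva hua
  obtain ⟨l, block, hblock⟩ := exists_cycles_of_reaches (M := M) (p := M.eval y) (t := t) huv hpos
    (by rintro (_ | _) <;> assumption)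
  have hl : 0 < l := by
    have hle := (hblock true).2.1.length_le
    rw [ht, (hblock true).1] at hle
    omega
  refine omegaBar_of_eventually_le (b := 1 / 15) (C := (y.length + l + u.length : ℕ))
    (by norm_num) (by exact_mod_cast (by omega)) (fun k => y.length + k * l + u.length)
    (fun k => by nlinarith) ?_ (.of_forall fun k => le_randSpace fun σ _ P hP => ?_)
  · filter_upwards [eventually_ge_atTop 1] with k hk
    exact_mod_cast add_mul_add_le_mul y.length l u.length hk
  · rw [one_div_mul_eq_div]
    refine le_logb_card_of_augmentedIndex hP k true (fun a => (a.flatMap block).reverse)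
      (fun b => (y ++ rep (block true) (k - b.length)).reverse) fun b c r hbr => ?_
    rw [blockCode_mem_SW ht hblock b c r hbr]
    cases c <;> simp [t, hua, hva]

/-! #### Forks -/

variable (M p) in
/-- A fork at the state `p`: after a prefix `s` of a cycle `v` through `p`, the automaton accepts
iff `d`, whereas it accepts iff `!d` after a word `e` of the same length as `s`. -/
structure IsFork (v s e : List α) (d : Bool) : Prop where
  cycle_ne_nil : v ≠ []
  evalFrom_cycle : M.evalFrom p v = p
  prefix_cycle : s <+: v
  length_eq : s.length = e.length
  mem_accept_prefix : M.evalFrom p s ∈ M.accept ↔ d = true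
  mem_accept_exit : M.evalFrom p e ∈ M.accept ↔ d = false

theorem exists_isFork [Finite σ] {t t' : List α} (hp : Recurrent M p)
    (htt : t.length = t'.length) (ht : M.evalFrom p t ∈ M.accept)
    (ht' : M.evalFrom p t' ∉ M.accept) :
    ∃ v s e d, IsFork M p v s e d ∧ (e = t ∨ e = t') ∧
      ∀ q, Recurrent M q → ∃ f, f.length = v.length ∧ M.evalFrom q f = q := by
  obtain ⟨m, hm, cycle_of_dvd⟩ := exists_common_period M
  have hdvd : m ∣ m * (t.length + 1) := dvd_mul_right _ _
  obtain ⟨v, hvlen, hv⟩ := cycle_of_dvd p hp _ hdvd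
  have hlt : t.length < v.length := by rw [hvlen]; nlinarith
  have hs : (v.take t.length).length = t.length := List.length_take_of_le hlt.le
  have hne : v ≠ [] := List.length_pos_iff.1 (by omega)
  have hcycle : ∀ q, Recurrent M q → ∃ f, f.length = v.length ∧ M.evalFrom q f = q :=
    fun q hq => hvlen ▸ cycle_of_dvd q hq _ hdvd
  by_cases hacc : M.evalFrom p (v.take t.length) ∈ M.accept
  · exact ⟨v, _, t', true, ⟨hne, hv, List.take_prefix _ _, hs.trans htt, by simp [hacc],
      by simp [ht']⟩, Or.inr rfl, hcycle⟩
  · exact ⟨v, _, t, false, ⟨hne, hv, List.take_prefix _ _, hs, by simp [hacc], by simp [ht]⟩,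
      Or.inl rfl, hcycle⟩

namespace IsFork

variable {pad : α} {y v s e : List α} {d : Bool} (F : IsFork M (M.eval y) v s e d)
include F

theorem mem_SW_iff_of_lt {N i j : ℕ} (h : N < j + i) (z : List α) :
    (rep v i ++ (e ++ z)).reverse ++ (y ++ rep v j).reverse ∈
      SW pad (y.length + N * v.length + e.length) M.accepts.reverse ↔ d = true := by
  rw [reverse_append_reverse_mem_SW (w := y ++ (rep v N ++ s)),
    eval_append_rep_append F.evalFrom_cycle, F.mem_accept_prefix]
  · simp only [List.length_append, length_rep, F.length_eq, add_assoc]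
  · rw [List.append_assoc, ← List.append_assoc (rep v _), ← rep_add, List.prefix_append_right_inj]
    exact (rep_append_prefix_rep F.prefix_cycle h).trans (List.prefix_append _ _)

theorem mem_SW_iff_of_add_eq {N i j r : ℕ} (h : j + i + r = N) {f z : List α}
    (hflen : f.length = r * v.length)
    (hf : M.evalFrom (M.evalFrom (M.eval y) e) f = M.evalFrom (M.eval y) e) (hz : f <+: z) :
    (rep v i ++ (e ++ z)).reverse ++ (y ++ rep v j).reverse ∈
      SW pad (y.length + N * v.length + e.length) M.accepts.reverse ↔ d = false := by
  subst h
  rw [reverse_append_reverse_mem_SW (w := y ++ (rep v (j + i) ++ (e ++ f))),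
    eval_append_rep_append F.evalFrom_cycle, DFA.evalFrom_of_append, hf,
    F.mem_accept_exit]
  · simp only [List.length_append, length_rep, hflen]
    ring
  · simpa only [rep_add, List.append_assoc, List.prefix_append_right_inj] using hz

theorem length_cycle_pos : 0 < v.length := List.length_pos_iff.2 F.cycle_ne_nil

end IsFork

/-! #### Logarithmic and doubly logarithmic space -/

theorem omegaBar_log2_of_not_lengthDetermined [Finite α] [Finite σ] (pad : α)
    (h : ¬ LengthDetermined M fun p q => Recurrent M p ∧ Recurrent M q) :
    OmegaBar (randSpace pad M.accepts.reverse) log2 := by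
  simp only [LengthDetermined, not_forall] at h
  obtain ⟨y, t, t', htt, ⟨hy, ht⟩, ⟨-, ht'⟩, hta, hta'⟩ := h
  obtain ⟨v, s, e, d, F, he, hcycle⟩ := exists_isFork hy htt hta hta'
  obtain ⟨f, hflen, hf⟩ := hcycle (M.evalFrom (M.eval y) e)
    (by rcases he with rfl | rfl <;> assumption)
  have hv := F.length_cycle_pos
  set D := y.length + v.length + e.length
  have hlogD : 0 ≤ Real.logb 2 D := Real.logb_nonneg one_lt_two (by exact_mod_cast (by omega))
  refine omegaBar_of_eventually_le (b := 1 / 15) (C := Real.logb 2 D + 1) (by norm_num)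
    (by positivity) (fun k => y.length + 2 ^ k * v.length + e.length)
    (fun k => by nlinarith [@Nat.lt_two_pow_self k]) ?_
    (.of_forall fun k => le_randSpace fun τ _ P hP => ?_)
  · filter_upwards [eventually_ge_atTop 1] with k hk
    have hk' : (1 : ℝ) ≤ k := by exact_mod_cast hk
    have hlog := log2_le (by positivity) (add_mul_add_le_mul y.length v.length e.length
      (@Nat.one_le_two_pow k))
    nlinarith
  · rw [one_div_mul_eq_div]
    refine le_logb_card_of_greaterThan hP k d (fun i => (rep v i ++ (e ++ rep f (2 ^ k))).reverse)
      (fun θ => (y ++ rep v (2 ^ k + 1 - θ)).reverse) fun i θ _ hθ => ?_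
    by_cases hiθ : θ ≤ i
    · rw [F.mem_SW_iff_of_lt (by omega), iff_true_left hiθ]
    · rw [F.mem_SW_iff_of_add_eq (r := θ - 1 - i) (by omega) (by rw [length_rep, hflen])
        (evalFrom_rep hf _) (rep_prefix_rep f (by omega)), iff_false_left hiθ, Bool.not_eq_true]

theorem IsFork.lt_card_pow {pad : α} {y v s e : List α} {d : Bool}
    (F : IsFork M (M.eval y) v s e d) {N : ℕ} {τ : Type*} [Finite τ] {P : ProbAutomaton α τ}
    (hP : P.IsFor (SW pad (y.length + N * v.length + e.length) M.accepts.reverse) (1 / 3)) :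
    N < (6 * Nat.card τ + 1) ^ Nat.card τ := by
  refine card_le_of_distinguishable hP (N + 1) (fun i => (rep v i ++ (e ++ [])).reverse)
    fun i j hij hj => ⟨(y ++ rep v (N - i)).reverse, ?_⟩
  rw [F.mem_SW_iff_of_add_eq (r := 0) (f := []) (by omega) (by simp) rfl List.nil_prefix,
    F.mem_SW_iff_of_lt (by omega)]
  cases d <;> simp

theorem le_logb_of_two_pow_two_pow_lt {k m : ℕ} (hk : 6 ≤ k)
    (h : 2 ^ 2 ^ k < (6 * m + 1) ^ m) : (1 / 4 : ℝ) * k ≤ Real.logb 2 m := by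
  have hm : 0 < m := Nat.pos_of_ne_zero (by rintro rfl; simp at h)
  have hpow : 2 ^ k ≤ (6 * m + 1) * m := by
    refine (Nat.pow_le_pow_iff_right one_lt_two).1 (h.le.trans ?_)
    rw [pow_mul]
    exact Nat.pow_le_pow_left Nat.lt_two_pow_self.le _
  have hsq : (2 : ℝ) ^ k ≤ 2 ^ 3 * (m : ℝ) ^ 2 := by
    exact_mod_cast (by nlinarith : 2 ^ k ≤ 2 ^ 3 * m ^ 2)
  have hm' : (m : ℝ) ^ 2 ≠ 0 := by positivity
  have hlog := Real.logb_le_logb_of_le one_lt_two (by positivity) hsq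
  rw [Real.logb_mul (by positivity) hm', Real.logb_pow, Real.logb_pow,
    Real.logb_pow, Real.logb_self_eq_one one_lt_two] at hlog
  have hk' : (6 : ℝ) ≤ k := by exact_mod_cast hk
  push_cast at hlog
  linarith

theorem omegaBar_loglog2_of_not_lengthDetermined [Finite α] [Finite σ] (pad : α)
    (h : ¬ LengthDetermined M fun p _ => Recurrent M p) :
    OmegaBar (randSpace pad M.accepts.reverse) loglog2 := by
  simp only [LengthDetermined, not_forall] at h
  obtain ⟨y, t, t', htt, hy, -, hta, hta'⟩ := h
  obtain ⟨v, s, e, d, F, -, -⟩ := exists_isFork hy htt hta hta'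
  have hv := F.length_cycle_pos
  set D := y.length + v.length + e.length
  have hlogD : 0 ≤ Real.logb 2 D := Real.logb_nonneg one_lt_two (by exact_mod_cast (by omega))
  set E := Real.logb 2 (Real.logb 2 D + 1)
  have hE : 0 ≤ E := Real.logb_nonneg one_lt_two (by linarith)
  have hpow (k : ℕ) : k < 2 ^ 2 ^ k := Nat.lt_two_pow_self.trans Nat.lt_two_pow_self
  refine omegaBar_of_eventually_le (b := 1 / 4) (C := E + 1) (by norm_num) (by positivity)
    (fun k => y.length + 2 ^ 2 ^ k * v.length + e.length) (fun k => by nlinarith [hpow k]) ?_ ?_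
  · filter_upwards [eventually_ge_atTop 2] with k hk
    have hk' : (2 : ℝ) ≤ k := by exact_mod_cast hk
    have hlog := loglog2_le (by nlinarith [hpow k])
      (add_mul_add_le_mul y.length v.length e.length (@Nat.one_le_two_pow (2 ^ k)))
    nlinarith
  · filter_upwards [eventually_ge_atTop 6] with k hk
    exact le_randSpace fun τ _ P hP => le_logb_of_two_pow_two_pow_lt hk (F.lt_card_pow hP)

end Streams

namespace ProbAutomaton

variable {σ τ : Type*}

/-- The automaton with exchanged answers. -/
def compl (P : ProbAutomaton α σ) : ProbAutomaton α σ := { P with accept := P.acceptᶜ }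

theorem IsFor.compl {P : ProbAutomaton α σ} {K : Language α} {ε : ℝ} (h : P.IsFor K ε) :
    P.compl.IsFor Kᶜ ε := by
  refine ⟨fun w hw => h.2 w hw, fun w hw => ?_⟩
  have := h.1 w (by_contra hw)
  change 1 - ε ≤ ((P.dist w).toOuterMeasure P.acceptᶜᶜ).toReal
  rwa [compl_compl]

theorem IsFor.mono {P : ProbAutomaton α σ} {K : Language α} {ε δ : ℝ} (h : P.IsFor K ε)
    (hε : ε ≤ δ) : P.IsFor K δ :=
  ⟨fun w hw => by linarith [h.1 w hw], fun w hw => by linarith [h.2 w hw]⟩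

/-- Independent parallel execution, accepting if both automata do. -/
noncomputable def prod (P : ProbAutomaton α σ) (Q : ProbAutomaton α τ) :
    ProbAutomaton α (σ × τ) where
  init := P.init.bind fun p => Q.init.map (Prod.mk p)
  step s a := (P.step s.1 a).bind fun p => (Q.step s.2 a).map (Prod.mk p)
  accept := {s | s.1 ∈ P.accept ∧ s.2 ∈ Q.accept}

theorem map_fst_bind_map_mk (μ : PMF σ) (ν : PMF τ) :
    (μ.bind fun p => ν.map (Prod.mk p)).map Prod.fst = μ := by
  rw [PMF.map_bind]
  simp only [PMF.map_comp]
  exact (congrArg μ.bind (funext fun p => PMF.map_const ν p)).trans μ.bind_pure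

theorem map_snd_bind_map_mk (μ : PMF σ) (ν : PMF τ) :
    (μ.bind fun p => ν.map (Prod.mk p)).map Prod.snd = ν := by
  rw [PMF.map_bind]
  simp only [PMF.map_comp]
  exact (congrArg μ.bind (funext fun _ => PMF.map_id ν)).trans (μ.bind_const ν)

theorem map_fst_dist_prod (P : ProbAutomaton α σ) (Q : ProbAutomaton α τ) (w : List α) :
    ((P.prod Q).dist w).map Prod.fst = P.dist w := by
  induction w using List.reverseRecOn with
  | nil => exact map_fst_bind_map_mk _ _
  | append_singleton w a ih =>
    rw [dist_snoc, dist_snoc, PMF.map_bind, ← ih, PMF.bind_map]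
    exact congrArg _ (funext fun s => map_fst_bind_map_mk _ _)

theorem map_snd_dist_prod (P : ProbAutomaton α σ) (Q : ProbAutomaton α τ) (w : List α) :
    ((P.prod Q).dist w).map Prod.snd = Q.dist w := by
  induction w using List.reverseRecOn with
  | nil => exact map_snd_bind_map_mk _ _
  | append_singleton w a ih =>
    rw [dist_snoc, dist_snoc, PMF.map_bind, ← ih, PMF.bind_map]
    exact congrArg _ (funext fun s => map_snd_bind_map_mk _ _)

theorem acceptProb_prod_le_left (P : ProbAutomaton α σ) (Q : ProbAutomaton α τ) (w : List α) :
    (P.prod Q).acceptProb w ≤ P.acceptProb w := by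
  rw [acceptProb, acceptProb, ← map_fst_dist_prod P Q, PMF.toOuterMeasure_map_apply]
  exact ENNReal.toReal_mono (toOuterMeasure_ne_top _ _)
    (MeasureTheory.measure_mono fun s hs => hs.1)

theorem acceptProb_prod_le_right (P : ProbAutomaton α σ) (Q : ProbAutomaton α τ) (w : List α) :
    (P.prod Q).acceptProb w ≤ Q.acceptProb w := by
  rw [acceptProb, acceptProb, ← map_snd_dist_prod P Q, PMF.toOuterMeasure_map_apply]
  exact ENNReal.toReal_mono (toOuterMeasure_ne_top _ _)
    (MeasureTheory.measure_mono fun s hs => hs.2)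

theorem rejectProb_prod_le (P : ProbAutomaton α σ) (Q : ProbAutomaton α τ) (w : List α) :
    (P.prod Q).rejectProb w ≤ P.rejectProb w + Q.rejectProb w := by
  rw [rejectProb, rejectProb, rejectProb, ← map_fst_dist_prod P Q, ← map_snd_dist_prod P Q,
    PMF.toOuterMeasure_map_apply, PMF.toOuterMeasure_map_apply,
    ← ENNReal.toReal_add (toOuterMeasure_ne_top _ _) (toOuterMeasure_ne_top _ _)]
  refine ENNReal.toReal_mono (ENNReal.add_ne_top.2 ⟨toOuterMeasure_ne_top _ _,
    toOuterMeasure_ne_top _ _⟩) (le_trans (MeasureTheory.measure_mono fun s hs => ?_)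
      (MeasureTheory.measure_union_le _ _))
  exact not_and_or.1 hs

theorem IsFor.inf {P : ProbAutomaton α σ} {Q : ProbAutomaton α τ} {K K' : Language α} {ε δ : ℝ}
    (hε : 0 ≤ ε) (hδ : 0 ≤ δ) (hP : P.IsFor K ε) (hQ : Q.IsFor K' δ) :
    (P.prod Q).IsFor (K ⊓ K') (ε + δ) := by
  rw [isFor_iff]
  refine ⟨fun w hw => ?_, fun w hw => ?_⟩
  · linarith [hP.1 w hw.1, hQ.1 w hw.2, rejectProb_prod_le P Q w, P.acceptProb_add_rejectProb w,
      Q.acceptProb_add_rejectProb w, (P.prod Q).acceptProb_add_rejectProb w]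
  · rcases not_and_or.1 hw with h | h
    · linarith [((P.isFor_iff _ _).1 hP).2 w h, acceptProb_prod_le_left P Q w]
    · linarith [((Q.isFor_iff _ _).1 hQ).2 w h, acceptProb_prod_le_right P Q w]

/-- Run one of finitely many automata, chosen uniformly at random. -/
noncomputable def mix {ι : Type*} [Fintype ι] [Nonempty ι] (P : ι → ProbAutomaton α σ) :
    ProbAutomaton α (ι × σ) where
  init := (PMF.uniformOfFintype ι).bind fun i => (P i).init.map (Prod.mk i)
  step s a := ((P s.1).step s.2 a).map (Prod.mk s.1)
  accept := {s | s.2 ∈ (P s.1).accept}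

theorem dist_mix {ι : Type*} [Fintype ι] [Nonempty ι] (P : ι → ProbAutomaton α σ) (w : List α) :
    (mix P).dist w =
      (PMF.uniformOfFintype ι).bind fun i => ((P i).dist w).map (Prod.mk i) := by
  induction w using List.reverseRecOn with
  | nil => rfl
  | append_singleton w a ih =>
    rw [dist_snoc, ih, PMF.bind_bind]
    refine congrArg _ (funext fun i => ?_)
    rw [PMF.bind_map, dist_snoc, PMF.map_bind]
    rfl

theorem acceptProb_mix {ι : Type*} [Fintype ι] [Nonempty ι] (P : ι → ProbAutomaton α σ)
    (w : List α) : (mix P).acceptProb w = (∑ i, (P i).acceptProb w) / Fintype.card ι := by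
  rw [acceptProb, dist_mix, PMF.toOuterMeasure_bind_apply, tsum_fintype,
    ENNReal.toReal_sum fun q _ => ENNReal.mul_ne_top (PMF.apply_ne_top _ _)
      (toOuterMeasure_ne_top _ _), Finset.sum_div]
  refine Finset.sum_congr rfl fun i _ => ?_
  rw [ENNReal.toReal_mul, PMF.uniformOfFintype_apply, PMF.toOuterMeasure_map_apply,
    ENNReal.toReal_inv, ENNReal.toReal_natCast, inv_mul_eq_div]
  rfl

end ProbAutomaton

/-! ### Streams that are longer than the window -/

theorem lastN_eq_rtake (pad : α) (n : ℕ) (w : List α) :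
    lastN pad n w = (List.replicate n pad ++ w).rtake n := by
  have h : List.replicate n pad = List.replicate (n - (n - w.length)) pad ++
      List.replicate (n - w.length) pad := by
    rw [List.replicate_append_replicate]; congr 1; omega
  rw [h, lastN, List.rtake_eq_reverse_take_reverse, List.rtake_eq_reverse_take_reverse,
    List.append_assoc, List.reverse_append (as := List.replicate (n - (n - w.length)) pad),
    List.take_append_of_le_length]
  simp only [List.length_reverse, List.length_append, List.length_replicate]
  omega

theorem exists_isFor_SW_of_rtake {σ : Type} (pad : α) {L : Language α} {n : ℕ} {ε : ℝ}
    (P : ProbAutomaton α σ)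
    (h1 : ∀ y : List α, n ≤ y.length → y.rtake n ∈ L → 1 - ε ≤ P.acceptProb y)
    (h0 : ∀ y : List α, n ≤ y.length → y.rtake n ∉ L → P.acceptProb y ≤ ε) :
    ∃ P' : ProbAutomaton α σ, P'.IsFor (SW pad n L) ε := by
  refine ⟨{ P with init := P.dist (List.replicate n pad) }, ?_⟩
  rw [ProbAutomaton.isFor_iff]
  have hacc : ∀ w, ({ P with init := P.dist (List.replicate n pad) } :
      ProbAutomaton α σ).acceptProb w = P.acceptProb (List.replicate n pad ++ w) := fun w => by
    simp [ProbAutomaton.acceptProb, ProbAutomaton.dist, List.foldl_append]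
  refine ⟨fun w hw => ?_, fun w hw => ?_⟩
  · rw [hacc]
    exact h1 _ (by simp) (lastN_eq_rtake pad n w ▸ hw)
  · rw [hacc]
    exact h0 _ (by simp) (lastN_eq_rtake pad n w ▸ hw)

/-- A coin toss that comes up `true` with probability `r`. -/
noncomputable def coin (r : NNReal) (hr : r ≤ 1) : PMF Bool :=
  PMF.ofFintype (fun b => if b then (r : ENNReal) else 1 - r) (by
    simpa using add_tsub_cancel_of_le (by exact_mod_cast hr))

theorem coin_apply (r : NNReal) (hr : r ≤ 1) (b : Bool) :
    coin r hr b = if b then (r : ENNReal) else 1 - r :=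
  PMF.ofFintype_apply _ _

/-! ### Counting the distance to the last occurrence -/

section Counter

variable {τ : Type} (M : DFA α τ)

open scoped Classical in
/-- The length of the shortest prefix of a word that leads from the given state to an accepting
one. -/
noncomputable def firstHit : List α → τ → Option ℕ
  | [], p => if p ∈ M.accept then some 0 else none
  | a :: z, p => if p ∈ M.accept then some 0 else (firstHit z (M.step p a)).map Nat.succ

theorem firstHit_of_mem {z : List α} {p : τ} (hp : p ∈ M.accept) : firstHit M z p = some 0 := by
  cases z <;> simp [firstHit, hp]

theorem evalFrom_take_of_firstHit {z : List α} {p : τ} {c : ℕ} (h : firstHit M z p = some c) :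
    c ≤ z.length ∧ M.evalFrom p (z.take c) ∈ M.accept := by
  induction z generalizing p c with
  | nil =>
    by_cases hp : p ∈ M.accept
    · simp only [firstHit, if_pos hp, Option.some.injEq] at h
      subst h; simpa using hp
    · simp [firstHit, hp] at h
  | cons a z ih =>
    by_cases hp : p ∈ M.accept
    · simp only [firstHit, if_pos hp, Option.some.injEq] at h
      subst h; simpa using hp
    · simp only [firstHit, if_neg hp, Option.map_eq_some_iff] at h
      obtain ⟨c, hc, rfl⟩ := h
      simpa using ih hc

theorem exists_firstHit_le {z : List α} {p : τ} {j : ℕ}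
    (h : M.evalFrom p (z.take j) ∈ M.accept) : ∃ c ≤ j, firstHit M z p = some c := by
  by_cases hp : p ∈ M.accept
  · exact ⟨0, Nat.zero_le _, firstHit_of_mem M hp⟩
  induction z generalizing p j with
  | nil => exact absurd (by simpa using h) hp
  | cons a z ih =>
    cases j with
    | zero => exact absurd (by simpa using h) hp
    | succ j =>
      rw [List.take_succ_cons, DFA.evalFrom_cons] at h
      simp only [firstHit, if_neg hp]
      by_cases hp' : M.step p a ∈ M.accept
      · exact ⟨1, by omega, by rw [firstHit_of_mem M hp']; rfl⟩
      · obtain ⟨c, hc, hcz⟩ := ih h hp'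
        exact ⟨c + 1, by omega, by rw [hcz]; rfl⟩

variable {V : Type} (f : V → V) (v₀ : V) (E : Set V) (r : NNReal) (hr : r ≤ 1)

open scoped Classical in
/-- The update of `counter` on the letter `a`; the bit `b` tells whether the stored values
survive. -/
noncomputable def counterStep (a : α) (b : Bool) (s : τ → Option V) : τ → Option V := fun p =>
  if p ∈ M.accept then some v₀ else if b then (s (M.step p a)).map f else none

open scoped Classical in
/-- For every state of `M`, store the value of `firstHit` on the reversed stream, represented by
the corresponding iterate of `f`; each stored value survives a step with probability `r`. -/
noncomputable def counter : ProbAutomaton α (τ → Option V) where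
  init := PMF.pure fun p => if p ∈ M.accept then some v₀ else none
  step s a := (coin r hr).map fun b => counterStep M f v₀ a b s
  accept := {s | ∃ v ∈ E, s M.start = some v}

theorem dist_counter_snoc (w : List α) (a : α) :
    (counter M f v₀ E r hr).dist (w ++ [a]) = (coin r hr).bind fun b =>
      ((counter M f v₀ E r hr).dist w).map (counterStep M f v₀ a b) := by
  rw [ProbAutomaton.dist_snoc]
  exact PMF.bind_comm _ _ _

theorem counterStep_of_mem {p : τ} (hp : p ∈ M.accept) (a : α) (b : Bool) (s : τ → Option V) :
    counterStep M f v₀ a b s p = some v₀ :=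
  if_pos hp

theorem preimage_counterStep_true {p : τ} (hp : p ∉ M.accept) (a : α) (G : Set V) :
    counterStep M f v₀ a true ⁻¹' {s | ∃ v ∈ G, s p = some v} =
      {s | ∃ v ∈ f ⁻¹' G, s (M.step p a) = some v} := by
  ext s
  simp only [Set.mem_preimage, Set.mem_ofPred_eq, counterStep, if_neg hp, if_true,
    Option.map_eq_some_iff]
  constructor
  · rintro ⟨_, hv, u, hu, rfl⟩
    exact ⟨u, hv, hu⟩
  · rintro ⟨u, hv, hu⟩
    exact ⟨_, hv, u, hu, rfl⟩

theorem preimage_counterStep_false {p : τ} (hp : p ∉ M.accept) (a : α) (G : Set V) :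
    counterStep M f v₀ a false ⁻¹' {s | ∃ v ∈ G, s p = some v} = ∅ := by
  ext s
  simp [counterStep, hp]

theorem toOuterMeasure_dist_counter_of_mem {p : τ} (hp : p ∈ M.accept) (w : List α) (a : α)
    (G : Set V) [Decidable (v₀ ∈ G)] :
    ((counter M f v₀ E r hr).dist (w ++ [a])).toOuterMeasure {s | ∃ v ∈ G, s p = some v} =
      if v₀ ∈ G then 1 else 0 := by
  rw [dist_counter_snoc]
  split_ifs with hG
  · refine (PMF.toOuterMeasure_apply_eq_one_iff _ _).2 fun s hs => ?_
    obtain ⟨b, -, hs⟩ := (PMF.mem_support_bind_iff _ _ _).1 hs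
    obtain ⟨s, -, rfl⟩ := (PMF.mem_support_map_iff _ _ _).1 hs
    exact ⟨v₀, hG, counterStep_of_mem M f v₀ hp a b s⟩
  · simp [PMF.toOuterMeasure_bind_apply, PMF.toOuterMeasure_map_apply, Set.preimage,
      counterStep_of_mem M f v₀ hp, hG]

theorem toOuterMeasure_dist_counter_of_notMem {p : τ} (hp : p ∉ M.accept) (w : List α) (a : α)
    (G : Set V) :
    ((counter M f v₀ E r hr).dist (w ++ [a])).toOuterMeasure {s | ∃ v ∈ G, s p = some v} =
      r * ((counter M f v₀ E r hr).dist w).toOuterMeasure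
        {s | ∃ v ∈ f ⁻¹' G, s (M.step p a) = some v} := by
  rw [dist_counter_snoc, PMF.toOuterMeasure_bind_apply, tsum_fintype, Fintype.sum_bool,
    PMF.toOuterMeasure_map_apply, PMF.toOuterMeasure_map_apply, preimage_counterStep_true M f v₀ hp,
    preimage_counterStep_false M f v₀ hp, MeasureTheory.measure_empty, mul_zero, add_zero,
    coin_apply, if_pos rfl]

open scoped Classical in
theorem toOuterMeasure_dist_counter (w : List α) (p : τ) (G : Set V) :
    ((counter M f v₀ E r hr).dist w).toOuterMeasure {s | ∃ v ∈ G, s p = some v} =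
      (firstHit M w.reverse p).elim 0 fun c => if f^[c] v₀ ∈ G then (r : ENNReal) ^ c else 0 := by
  induction w using List.reverseRecOn generalizing p G with
  | nil =>
    change (PMF.pure _).toOuterMeasure _ = _
    rw [PMF.toOuterMeasure_pure_apply]
    by_cases hp : p ∈ M.accept <;> simp [firstHit, hp]
  | append_singleton w a ih =>
    rw [List.reverse_append, List.reverse_singleton, List.singleton_append]
    by_cases hp : p ∈ M.accept
    · rw [toOuterMeasure_dist_counter_of_mem M f v₀ E r hr hp, firstHit_of_mem M hp]
      simp
    · rw [toOuterMeasure_dist_counter_of_notMem M f v₀ E r hr hp, ih, firstHit, if_neg hp]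
      cases firstHit M w.reverse (M.step p a) with
      | none => simp
      | some c =>
        simp only [Option.elim_some, Option.map_some, Function.iterate_succ_apply',
          Set.mem_preimage, Nat.succ_eq_add_one]
        split_ifs <;> simp [pow_succ']

open scoped Classical in
theorem acceptProb_counter (w : List α) :
    (counter M f v₀ E r hr).acceptProb w =
      (firstHit M w.reverse M.start).elim 0 fun c => if f^[c] v₀ ∈ E then (r : ℝ) ^ c else 0 := by
  rw [ProbAutomaton.acceptProb,
    show (counter M f v₀ E r hr).accept = {s | ∃ v ∈ E, s M.start = some v} from rfl,
    toOuterMeasure_dist_counter]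
  cases firstHit M w.reverse M.start with
  | none => simp
  | some c => simp only [Option.elim_some]; split_ifs <;> simp

end Counter

/-! ### Upper bounds on the space complexity -/

/-- For every positive error probability the sliding window problem of `L` has algorithms that use
`O(f)` bits. Unlike a bound at error `1/3`, this is closed under Boolean combinations. -/
def HasCost (pad : α) (f : ℕ → ℝ) (L : Language α) : Prop :=
  ∀ ε : ℝ, 0 < ε → ∃ C : ℝ, ∀ᶠ n in atTop, ∃ (σ : Type) (_ : Finite σ) (P : ProbAutomaton α σ),
    P.IsFor (SW pad n L) ε ∧ Real.logb 2 (Nat.card σ) ≤ C * f n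

theorem logb_card_nonneg {σ : Type*} [Finite σ] (P : ProbAutomaton α σ) :
    0 ≤ Real.logb 2 (Nat.card σ) :=
  have := P.nonempty_state
  Real.logb_nonneg one_lt_two (by exact_mod_cast Nat.card_pos (α := σ))

theorem randSpace_le {pad : α} {L : Language α} {n : ℕ} {σ : Type} [Finite σ]
    {P : ProbAutomaton α σ} (h : P.IsFor (SW pad n L) (1 / 3)) :
    randSpace pad L n ≤ Real.logb 2 (Nat.card σ) := by
  refine csInf_le ⟨0, ?_⟩ ⟨σ, inferInstance, P, h, rfl⟩
  rintro _ ⟨σ, _, P, -, rfl⟩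
  exact logb_card_nonneg P

theorem randSpace_nonneg [Finite α] (pad : α) (L : Language α) (n : ℕ) :
    0 ≤ randSpace pad L n :=
  le_randSpace fun _ _ P _ => logb_card_nonneg P

theorem HasCost.isBigO [Finite α] {pad : α} {f : ℕ → ℝ} {L : Language α} (h : HasCost pad f L) :
    randSpace pad L =O[atTop] f := by
  obtain ⟨C, hC⟩ := h (1 / 3) (by norm_num)
  refine IsBigO.of_bound |C| (hC.mono ?_)
  rintro n ⟨σ, _, P, hP, hle⟩
  rw [Real.norm_of_nonneg (randSpace_nonneg _ _ _), Real.norm_eq_abs, ← abs_mul]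
  exact ((randSpace_le hP).trans hle).trans (le_abs_self _)

theorem HasCost.mono {pad : α} {f g : ℕ → ℝ} {L : Language α} (h : HasCost pad f L)
    (hfg : ∀ᶠ n in atTop, |f n| ≤ g n) : HasCost pad g L := by
  intro ε hε
  obtain ⟨C, hC⟩ := h ε hε
  refine ⟨|C|, ?_⟩
  filter_upwards [hC, hfg] with n ⟨σ, hσ, P, hP, hle⟩ hn
  refine ⟨σ, hσ, P, hP, hle.trans ?_⟩
  calc C * f n ≤ |C| * |f n| := (le_abs_self _).trans_eq (abs_mul _ _)
    _ ≤ |C| * g n := by gcongr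

theorem HasCost.compl {pad : α} {f : ℕ → ℝ} {L : Language α} (h : HasCost pad f L) :
    HasCost pad f Lᶜ := by
  intro ε hε
  obtain ⟨C, hC⟩ := h ε hε
  exact ⟨C, hC.mono fun n ⟨σ, hσ, P, hP, hle⟩ => ⟨σ, hσ, P.compl, hP.compl, hle⟩⟩

theorem HasCost.inf {pad : α} {f : ℕ → ℝ} {L L' : Language α} (h : HasCost pad f L)
    (h' : HasCost pad f L') : HasCost pad f (L ⊓ L') := by
  intro ε hε
  obtain ⟨C, hC⟩ := h (ε / 2) (by positivity)
  obtain ⟨C', hC'⟩ := h' (ε / 2) (by positivity)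
  refine ⟨C + C', ?_⟩
  filter_upwards [hC, hC'] with n ⟨σ, hσ, P, hP, hle⟩ ⟨σ', hσ', P', hP', hle'⟩
  refine ⟨σ × σ', inferInstance, P.prod P', ?_, ?_⟩
  · rw [← add_halves ε]
    exact hP.inf (by positivity) (by positivity) hP'
  · have := P.nonempty_state
    have := P'.nonempty_state
    rw [Nat.card_prod, Nat.cast_mul, Real.logb_mul (by exact_mod_cast Nat.card_pos.ne')
      (by exact_mod_cast Nat.card_pos.ne'), add_mul]
    exact add_le_add hle hle'

theorem hasCost_of_mem_Len (pad : α) (f : ℕ → ℝ) {L : Language α} (h : L ∈ Len α) :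
    HasCost pad f L := by
  intro ε hε
  refine ⟨0, Eventually.of_forall fun n => ?_⟩
  let P (A : Set Unit) : ProbAutomaton α Unit := ⟨PMF.pure (), fun _ _ => PMF.pure (), A⟩
  have prob_univ (p : PMF Unit) : (p.toOuterMeasure Set.univ).toReal = 1 := by
    rw [(p.toOuterMeasure_apply_eq_one_iff _).2 (Set.subset_univ _), ENNReal.toReal_one]
  rcases h.2 n with hall | hnone
  · refine ⟨Unit, inferInstance, P Set.univ, ⟨fun w _ => ?_,
      fun w hw => (hw (hall _ (lastN_length _ _ _))).elim⟩, by simp⟩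
    exact (sub_le_self 1 hε.le).trans_eq (prob_univ _).symm
  · refine ⟨Unit, inferInstance, P ∅,
      ⟨fun w hw => (hnone _ (lastN_length _ _ _) hw).elim, fun w _ => ?_⟩, by simp⟩
    rw [ProbAutomaton.rejectProb, Set.compl_empty, prob_univ]
    linarith

theorem bot_mem_Len : (⊥ : Language α) ∈ Len α :=
  ⟨isRegular_accepts (⟨fun _ _ => (), (), ∅⟩ : DFA α Unit), fun _ => Or.inr fun _ _ hw => hw⟩

theorem hasCost_of_mem_boolComb {pad : α} {f : ℕ → ℝ} {C : Set (Language α)}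
    (h : ∀ K ∈ C, HasCost pad f K) {L : Language α} (hL : L ∈ BoolComb C) : HasCost pad f L := by
  refine BooleanSubalgebra.closure_bot_sup_induction (p := fun K _ => HasCost pad f K) h
    (hasCost_of_mem_Len pad f bot_mem_Len) (fun K _ K' _ hK hK' => ?_) (fun K _ hK => hK.compl) hL
  simpa only [compl_inf, compl_compl] using (hK.compl.inf hK'.compl).compl

section Counter

variable {τ : Type} {M : DFA α τ}

theorem rtake_mem_reverse_accepts_iff {n : ℕ} {y : List α} :
    y.rtake n ∈ M.accepts.reverse ↔ M.eval (y.reverse.take n) ∈ M.accept := by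
  rw [mem_reverse_accepts, List.rtake_eq_reverse_take_reverse, List.reverse_reverse]

theorem rtake_mem_top_mul_reverse_accepts_iff {n : ℕ} {y : List α} :
    y.rtake n ∈ ⊤ * M.accepts.reverse ↔ ∃ c ≤ n, firstHit M y.reverse M.start = some c := by
  rw [mem_top_mul_reverse_iff, List.rtake_eq_reverse_take_reverse, List.reverse_reverse]
  constructor
  · rintro ⟨v, hv, hvy⟩
    have hv_eq : v = y.reverse.take v.length :=
      List.prefix_iff_eq_take.1 (hvy.trans (List.take_prefix _ _))
    rw [hv_eq] at hv
    obtain ⟨c, hc, hfc⟩ := exists_firstHit_le M hv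
    exact ⟨c, hc.trans (hvy.length_le.trans (List.length_take_le _ _)), hfc⟩
  · rintro ⟨c, hc, hfc⟩
    exact ⟨y.reverse.take c, (evalFrom_take_of_firstHit M hfc).2,
      List.take_prefix_take_left hc⟩

theorem exists_isFor_SW_top_mul {V : Type} (pad : α) {n : ℕ} {ε : ℝ} (hε : 0 ≤ ε) {f : V → V}
    {v₀ : V} {E : Set V}
    (hE : ∀ z c, firstHit M z M.start = some c → (f^[c] v₀ ∈ E ↔ c ≤ n)) :
    ∃ P : ProbAutomaton α (τ → Option V), P.IsFor (SW pad n (⊤ * M.accepts.reverse)) ε := by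
  refine exists_isFor_SW_of_rtake pad (counter M f v₀ E 1 le_rfl)
    (fun y _ hy => ?_) (fun y _ hy => ?_)
  · obtain ⟨c, hcn, hc⟩ := rtake_mem_top_mul_reverse_accepts_iff.1 hy
    rw [acceptProb_counter, hc, Option.elim_some, if_pos ((hE _ c hc).2 hcn)]
    simpa using hε
  · rw [acceptProb_counter]
    cases hc : firstHit M y.reverse M.start with
    | none => simpa using hε
    | some c =>
      have hcn : ¬ c ≤ n := fun hcn => hy (rtake_mem_top_mul_reverse_accepts_iff.2 ⟨c, hcn, hc⟩)
      rwa [Option.elim_some, if_neg ((hE _ c hc).not.2 hcn)]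

end Counter

theorem isRegular_singleton [Finite α] (w : List α) : ({w} : Language α).IsRegular := by
  refine isRegular_of_mem_iff_take_mem (w.length + 1) fun u => ?_
  change u = w ↔ u.take (w.length + 1) = w
  refine ⟨fun h => by simp [h], fun h => ?_⟩
  have hlen := congrArg List.length h
  rw [List.length_take] at hlen
  rwa [List.take_of_length_le (by omega)] at h

theorem hasCost_top_mul_singleton [Finite α] (pad : α) (w : List α) :
    HasCost pad (fun _ => 1) (⊤ * {w} : Language α) := by
  obtain ⟨τ, _, M, hM⟩ := exists_eq_reverse_accepts (isRegular_singleton w)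
  intro ε hε
  refine ⟨Real.logb 2 (Nat.card (τ → Option Unit)), ?_⟩
  filter_upwards [eventually_ge_atTop w.length] with n hn
  have hlen z c (h : firstHit M z M.start = some c) : c ≤ n := by
    obtain ⟨hcz, hacc⟩ := evalFrom_take_of_firstHit M h
    have hw : (z.take c).reverse ∈ ({w} : Language α) := by
      rw [hM, mem_reverse_accepts, List.reverse_reverse]
      exact hacc
    rw [← Set.mem_singleton_iff.1 hw, List.length_reverse, List.length_take] at hn
    omega
  obtain ⟨P, hP⟩ := exists_isFor_SW_top_mul (V := Unit) pad hε.le (f := id) (v₀ := ())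
    (E := Set.univ) fun z c h => iff_of_true trivial (hlen z c h)
  exact ⟨_, inferInstance, P, hM ▸ hP, by simp⟩

theorem hasCost_of_mem_ST [Finite α] (pad : α) {L : Language α} (h : L ∈ ST α) :
    HasCost pad (fun _ => 1) L := by
  refine hasCost_of_mem_boolComb ?_ h
  rintro _ ⟨w, rfl⟩
  exact hasCost_top_mul_singleton pad w

theorem logb_card_counter_le (τ : Type*) [Finite τ] {m : ℕ} {x : ℝ} (h : (m : ℝ) + 1 ≤ x) :
    Real.logb 2 (Nat.card (τ → Option (Fin m))) ≤ Nat.card τ * Real.logb 2 x := by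
  rw [Nat.card_fun, Finite.card_option, Nat.card_fin, Nat.cast_pow, Real.logb_pow]
  gcongr
  · norm_num
  · exact_mod_cast h

theorem hasCost_of_mem_LI (pad : α) {L : Language α} (h : L ∈ LI α) :
    HasCost pad log2 L := by
  obtain ⟨K, hK, rfl⟩ := h
  obtain ⟨τ, _, M, rfl⟩ := exists_eq_reverse_accepts hK
  intro ε hε
  refine ⟨Nat.card τ * 2, ?_⟩
  filter_upwards [eventually_ge_atTop 3] with n hn
  let cappedSucc (v : Fin (n + 2)) : Fin (n + 2) := ⟨min (v + 1) (n + 1), by omega⟩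
  have cappedSucc_iterate (c : ℕ) : (cappedSucc^[c] 0 : ℕ) = min c (n + 1) := by
    induction c with
    | zero => simp
    | succ c ih =>
      rw [Function.iterate_succ_apply']
      simp only [cappedSucc, ih]
      omega
  obtain ⟨P, hP⟩ := exists_isFor_SW_top_mul (M := M) pad (n := n) hε.le (f := cappedSucc)
    (v₀ := 0) (E := {v | (v : ℕ) ≤ n}) fun _ c _ => by
      rw [Set.mem_ofPred_eq, cappedSucc_iterate]
      omega
  refine ⟨_, inferInstance, P, hP, ?_⟩
  have hcard : ((n + 2 : ℕ) : ℝ) + 1 ≤ (n : ℝ) ^ 2 := by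
    have : (3 : ℝ) ≤ n := by exact_mod_cast hn
    push_cast
    nlinarith
  calc Real.logb 2 (Nat.card (τ → Option (Fin (n + 2))))
      ≤ Nat.card τ * Real.logb 2 ((n : ℝ) ^ 2) := logb_card_counter_le τ hcard
    _ = Nat.card τ * 2 * log2 n := by
      rw [Real.logb_pow, log2, Nat.cast_ofNat, mul_assoc]

/-! ### Suffix-free languages -/

theorem eventually_sqrt_le_primeCounting :
    ∀ᶠ m : ℕ in atTop, √(m : ℝ) ≤ Nat.primeCounting m := by
  have log_le : ∀ᶠ x : ℝ in atTop, ‖Real.log x‖ ≤ (1 / 8) * ‖x ^ (1 / 2 : ℝ)‖ :=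
    (isLittleO_log_rpow_atTop (by norm_num)).bound (by norm_num)
  filter_upwards [tendsto_natCast_atTop_atTop.eventually log_le, eventually_ge_atTop 4]
    with m hm hm4
  have hm4' : (4 : ℝ) ≤ m := by exact_mod_cast hm4
  have hlog : 0 < Real.log m := Real.log_pos (by linarith)
  rw [← Real.sqrt_eq_rpow, Real.norm_of_nonneg hlog.le, Real.norm_of_nonneg (Real.sqrt_nonneg _)]
    at hm
  have sqrt_mul_sqrt : √(m : ℝ) * √(m : ℝ) = m := Real.mul_self_sqrt (by positivity)
  have two_le_sqrt : 2 ≤ √(m : ℝ) := Real.le_sqrt_of_sq_le (by linarith)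
  have log_succ_le : Real.log (m + 1) ≤ 2 * Real.log m := by
    rw [show (2 : ℝ) * Real.log m = Real.log ((m : ℝ) ^ 2) by simp]
    exact Real.log_le_log (by positivity) (by nlinarith)
  have chebyshev := (Chebyshev.psi_ge m).trans (Chebyshev.psi_le_primeCounting_mul_log m)
  have log_two := Real.log_two_gt_d9
  exact le_of_mul_le_mul_right (by nlinarith) hlog

theorem two_pow_card_primeFactors_le {d : ℕ} (hd : d ≠ 0) : 2 ^ d.primeFactors.card ≤ d :=
  (Finset.pow_card_le_prod _ _ _ fun _ hp => (Nat.prime_of_mem_primeFactors hp).two_le).trans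
    (Nat.le_of_dvd hd.bot_lt (Nat.prod_primeFactors_dvd d))

theorem card_filter_modEq_le {T : Finset ℕ} (hT : ∀ p ∈ T, p.Prime) {c n : ℕ} (hcn : c ≠ n) {B : ℝ}
    (hc : c ≤ B) (hn : n ≤ B) : ({p ∈ T | c ≡ n [MOD p]}.card : ℝ) ≤ Real.logb 2 B := by
  wlog hlt : c < n generalizing c n
  · simpa only [Nat.ModEq.comm] using this hcn.symm hn hc (hcn.lt_or_gt.resolve_left hlt)
  have hsub : {p ∈ T | c ≡ n [MOD p]} ⊆ (n - c).primeFactors := fun p hp => by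
    rw [Finset.mem_filter] at hp
    exact Nat.mem_primeFactors.2 ⟨hT p hp.1, (Nat.modEq_iff_dvd' hlt.le).1 hp.2, by omega⟩
  have hpow : 2 ^ {p ∈ T | c ≡ n [MOD p]}.card ≤ n :=
    calc 2 ^ {p ∈ T | c ≡ n [MOD p]}.card ≤ 2 ^ (n - c).primeFactors.card := by gcongr; norm_num
      _ ≤ n - c := two_pow_card_primeFactors_le (by omega)
      _ ≤ n := Nat.sub_le n c
  have hpow' : (2 : ℝ) ^ {p ∈ T | c ≡ n [MOD p]}.card ≤ B := le_trans (by exact_mod_cast hpow) hn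
  rwa [Real.le_logb_iff_rpow_le one_lt_two (lt_of_lt_of_le (by positivity) hpow'),
    Real.rpow_natCast]

theorem one_sub_pow_mul_le {q : ℝ} (h0 : 0 ≤ q) (h1 : q ≤ 1) (c : ℕ) :
    (1 - q) ^ c * (1 + c * q) ≤ 1 := by
  calc (1 - q) ^ c * (1 + c * q) ≤ (1 - q) ^ c * (1 + q) ^ c :=
        mul_le_mul_of_nonneg_left (one_add_mul_le_pow (by linarith) c)
          (pow_nonneg (by linarith) c)
    _ = (1 - q * q) ^ c := by rw [← mul_pow]; ring
    _ ≤ 1 := pow_le_one₀ (by nlinarith) (by nlinarith)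

/- A count `c ≠ n` collides with `n` modulo few primes if it is at most `n / ε ^ 2`, and a larger
count is unlikely to survive. -/
theorem card_filter_modEq_mul_pow_le {T : Finset ℕ} (hT : ∀ p ∈ T, p.Prime) {ε : ℝ} (hε : 0 < ε)
    (hε1 : ε ≤ 1) {c n : ℕ} (hcn : c ≠ n) (hn : 0 < n)
    (hB : Real.logb 2 (n / ε ^ 2) ≤ ε * T.card) :
    {p ∈ T | c ≡ n [MOD p]}.card * (1 - ε / n) ^ c ≤ ε * T.card := by
  have hn' : (1 : ℝ) ≤ n := by exact_mod_cast hn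
  have hq0 : 0 ≤ ε / n := by positivity
  have hq1 : ε / n ≤ 1 := (div_le_one (by positivity)).2 (hε1.trans hn')
  have hpow0 : 0 ≤ (1 - ε / n) ^ c := pow_nonneg (by linarith) c
  rcases le_total (c : ℝ) (n / ε ^ 2) with hc | hc
  · have hnB : (n : ℝ) ≤ n / ε ^ 2 :=
      le_div_self (by positivity) (by positivity) (pow_le_one₀ hε.le hε1)
    have hpow1 : (1 - ε / n) ^ c ≤ 1 := pow_le_one₀ (by linarith) (by linarith)
    exact (mul_le_of_le_one_right (Nat.cast_nonneg _) hpow1).trans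
      ((card_filter_modEq_le hT hcn hc hnB).trans hB)
  · have hcq : 1 / ε ≤ c * (ε / n) := by
      calc 1 / ε = n / ε ^ 2 * (ε / n) := by field_simp
        _ ≤ c * (ε / n) := by gcongr
    have hpow : (1 - ε / n) ^ c ≤ ε := by
      rw [← div_le_one hε, ← mul_one_div]
      exact (mul_le_mul_of_nonneg_left (by linarith) hpow0).trans (one_sub_pow_mul_le hq0 hq1 c)
    rw [mul_comm ε]
    gcongr
    exact Finset.filter_subset _ _

section RandomPrimeCounter

/-- Addition of one modulo `p`, on a counter that ranges over `Fin (m + 1)` for every `p ≤ m`. -/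
def modSucc (m p : ℕ) (v : Fin (m + 1)) : Fin (m + 1) := Fin.ofNat (m + 1) ((v + 1) % p)

theorem modSucc_iterate_zero {m p : ℕ} (hp : 0 < p) (hpm : p ≤ m) (c : ℕ) :
    (((modSucc m p)^[c] 0 : Fin (m + 1)) : ℕ) = c % p := by
  induction c with
  | zero => simp
  | succ c ih =>
    rw [Function.iterate_succ_apply']
    change (((modSucc m p)^[c] 0 : Fin (m + 1)) + 1 : ℕ) % p % (m + 1) = _
    rw [ih, Nat.mod_add_mod]
    exact Nat.mod_eq_of_lt (Nat.lt_succ_of_le ((Nat.mod_lt _ hp).le.trans hpm))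

variable {τ : Type} (M : DFA α τ) (m n : ℕ) (r : NNReal) (hr : r ≤ 1)

/-- The `counter` that tests modulo `p` whether the first hit occurs after `n` letters. -/
noncomputable def modCounter (p : ℕ) : ProbAutomaton α (τ → Option (Fin (m + 1))) :=
  counter M (modSucc m p) 0 {v | (v : ℕ) ≡ n [MOD p]} r hr

theorem acceptProb_modCounter {p : ℕ} (hp : 0 < p) (hpm : p ≤ m) (w : List α) :
    (modCounter M m n r hr p).acceptProb w =
      (firstHit M w.reverse M.start).elim 0 fun c => if c ≡ n [MOD p] then (r : ℝ) ^ c else 0 := by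
  rw [modCounter, acceptProb_counter]
  cases firstHit M w.reverse M.start with
  | none => rfl
  | some c =>
    simp only [Set.mem_ofPred_eq, modSucc_iterate_zero hp hpm, Nat.ModEq, Nat.mod_mod,
      Option.elim_some]
    congr

variable [Nonempty (Nat.primesLE m)]

/-- The `modCounter` for a random prime at most `m`. -/
noncomputable def randomPrimeCounter :
    ProbAutomaton α (Nat.primesLE m × (τ → Option (Fin (m + 1)))) :=
  ProbAutomaton.mix fun p => modCounter M m n r hr p

theorem acceptProb_randomPrimeCounter (w : List α) :
    (randomPrimeCounter M m n r hr).acceptProb w =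
      (firstHit M w.reverse M.start).elim 0 fun c =>
        {p ∈ Nat.primesLE m | c ≡ n [MOD p]}.card * (r : ℝ) ^ c / Nat.primeCounting m := by
  have hp (p : Nat.primesLE m) := acceptProb_modCounter M m n r hr
    (Nat.prime_of_mem_primesLE p.2).pos (Nat.le_of_mem_primesLE p.2) w
  rw [randomPrimeCounter, ProbAutomaton.acceptProb_mix, Fintype.card_coe,
    Nat.primesLE_card_eq_primeCounting]
  simp only [hp]
  cases firstHit M w.reverse M.start with
  | none => simp
  | some c =>
    simp only [Option.elim_some]
    rw [Finset.sum_coe_sort _ fun p => if c ≡ n [MOD p] then (r : ℝ) ^ c else 0,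
      ← Finset.sum_filter, Finset.sum_const, nsmul_eq_mul]

end RandomPrimeCounter

theorem rtake_mem_iff_firstHit_eq {τ : Type} {M : DFA α τ}
    (hSF : ∀ x y, x ++ y ∈ M.accepts.reverse → x ≠ [] → y ∉ M.accepts.reverse) {n : ℕ}
    {y : List α} (hy : n ≤ y.length) :
    y.rtake n ∈ M.accepts.reverse ↔ firstHit M y.reverse M.start = some n := by
  rw [rtake_mem_reverse_accepts_iff]
  refine ⟨fun h => ?_, fun h => (evalFrom_take_of_firstHit M h).2⟩
  obtain ⟨c, hcn, hc⟩ := exists_firstHit_le M h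
  obtain rfl | hlt := hcn.eq_or_lt
  · exact hc
  obtain ⟨e, he⟩ := List.take_prefix_take_left (l := y.reverse) hcn
  refine absurd ?_ (hSF e.reverse (y.reverse.take c).reverse ?_ ?_)
  · rw [mem_reverse_accepts, List.reverse_reverse]
    exact (evalFrom_take_of_firstHit M hc).2
  · rwa [← List.reverse_append, he, mem_reverse_accepts, List.reverse_reverse]
  · intro he_nil
    have hlen := congrArg List.length he
    rw [List.reverse_eq_nil_iff.1 he_nil, List.append_nil, List.length_take, List.length_take,
      List.length_reverse] at hlen
    omega

theorem exists_isFor_SW_of_suffixFree (pad : α) {τ : Type} {M : DFA α τ}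
    (hSF : ∀ x y, x ++ y ∈ M.accepts.reverse → x ≠ [] → y ∉ M.accepts.reverse) {ε : ℝ}
    (hε : 0 < ε) (hε1 : ε ≤ 1) {n m : ℕ} (hn : 0 < n) (hm : 2 ≤ m)
    (hB : Real.logb 2 (n / ε ^ 2) ≤ ε * Nat.primeCounting m) :
    ∃ P : ProbAutomaton α (Nat.primesLE m × (τ → Option (Fin (m + 1)))),
      P.IsFor (SW pad n M.accepts.reverse) ε := by
  have : Nonempty (Nat.primesLE m) := ⟨⟨2, Nat.mem_primesLE.2 ⟨hm, Nat.prime_two⟩⟩⟩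
  have hπ : (0 : ℝ) < Nat.primeCounting m := by
    rw [← Nat.primesLE_card_eq_primeCounting]
    exact_mod_cast Finset.card_pos.2 (Finset.nonempty_coe_sort.1 this)
  have hn' : (1 : ℝ) ≤ n := by exact_mod_cast hn
  have hq : ε / n ≤ 1 := (div_le_one (by positivity)).2 (hε1.trans hn')
  let r : NNReal := ⟨1 - ε / n, sub_nonneg.2 hq⟩
  have hr : r ≤ 1 := sub_le_self (1 : ℝ) (by positivity)
  refine exists_isFor_SW_of_rtake pad (randomPrimeCounter M m n r hr) (fun y hy hyL => ?_)
    (fun y hy hyL => ?_)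
  · rw [rtake_mem_iff_firstHit_eq hSF hy] at hyL
    have survives : 1 - ε ≤ (1 - ε / n) ^ n := by
      refine le_trans (le_of_eq ?_) (one_add_mul_sub_le_pow (by linarith) n)
      field_simp
      ring
    rw [acceptProb_randomPrimeCounter, hyL, Option.elim_some,
      Finset.filter_true_of_mem fun _ _ => Nat.ModEq.refl n, Nat.primesLE_card_eq_primeCounting,
      mul_div_cancel_left₀ _ hπ.ne']
    exact survives
  · rw [rtake_mem_iff_firstHit_eq hSF hy] at hyL
    rw [acceptProb_randomPrimeCounter]
    cases hc : firstHit M y.reverse M.start with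
    | none => exact hε.le
    | some c =>
      rw [← Nat.primesLE_card_eq_primeCounting] at hB hπ ⊢
      exact (div_le_iff₀ hπ).2 (card_filter_modEq_mul_pow_le
        (fun p hp => Nat.prime_of_mem_primesLE hp) hε hε1 (by rintro rfl; exact hyL hc) hn hB)

theorem tendsto_log2 : Tendsto log2 atTop atTop :=
  (Real.tendsto_logb_atTop one_lt_two).comp tendsto_natCast_atTop_atTop

theorem tendsto_loglog2 : Tendsto loglog2 atTop atTop :=
  (Real.tendsto_logb_atTop one_lt_two).comp tendsto_log2

theorem tendsto_ceil_log2_pow_four : Tendsto (fun n : ℕ => ⌈log2 n ^ 4⌉₊) atTop atTop :=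
  tendsto_nat_ceil_atTop.comp ((tendsto_pow_atTop (by norm_num)).comp tendsto_log2)

theorem eventually_logb_div_le_primeCounting {ε : ℝ} (hε : 0 < ε) :
    ∀ᶠ n : ℕ in atTop, Real.logb 2 (n / ε ^ 2) ≤ ε * Nat.primeCounting ⌈log2 n ^ 4⌉₊ := by
  filter_upwards [tendsto_ceil_log2_pow_four.eventually eventually_sqrt_le_primeCounting,
    eventually_gt_atTop 0, tendsto_log2.eventually_ge_atTop 0,
    tendsto_log2.eventually_ge_atTop (2 / ε),
    tendsto_log2.eventually_ge_atTop (Real.logb 2 (1 / ε ^ 2))] with n hπ hn hlog hlogε hlogB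
  have hn' : (n : ℝ) ≠ 0 := by exact_mod_cast hn.ne'
  have le_sqrt : log2 n ^ 2 ≤ √(⌈log2 n ^ 4⌉₊ : ℝ) := by
    apply Real.le_sqrt_of_sq_le
    rw [← pow_mul]
    exact Nat.le_ceil _
  calc Real.logb 2 (n / ε ^ 2) = log2 n + Real.logb 2 (1 / ε ^ 2) := by
        rw [div_eq_mul_one_div, Real.logb_mul hn' (by positivity), log2]
    _ ≤ 2 * log2 n := by linarith
    _ ≤ ε * log2 n * log2 n := by gcongr; exact (div_le_iff₀' hε).1 hlogε
    _ = ε * log2 n ^ 2 := by ring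
    _ ≤ ε * Nat.primeCounting ⌈log2 n ^ 4⌉₊ := by gcongr; exact le_sqrt.trans hπ

theorem eventually_logb_ceil_le :
    ∀ᶠ n : ℕ in atTop, Real.logb 2 ((⌈log2 n ^ 4⌉₊ : ℝ) + 2) ≤ 5 * loglog2 n := by
  filter_upwards [tendsto_log2.eventually_ge_atTop 2] with n hlog
  have hceil : (⌈log2 n ^ 4⌉₊ : ℝ) + 2 ≤ log2 n ^ 5 := by
    have hlt := Nat.ceil_lt_add_one (show 0 ≤ log2 n ^ 4 by positivity)
    have hpow : (2 : ℝ) ^ 4 ≤ log2 n ^ 4 := by gcongr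
    have hmul : 2 * log2 n ^ 4 ≤ log2 n ^ 5 := by
      rw [pow_succ' _ 4]
      gcongr
    linarith
  calc Real.logb 2 ((⌈log2 n ^ 4⌉₊ : ℝ) + 2) ≤ Real.logb 2 (log2 n ^ 5) :=
        Real.logb_le_logb_of_le one_lt_two (by positivity) hceil
    _ = 5 * loglog2 n := by rw [Real.logb_pow, loglog2, log2, Nat.cast_ofNat]

theorem logb_card_randomPrimeCounter_le (τ : Type*) [Finite τ] {m : ℕ} (hm : 2 ≤ m) :
    Real.logb 2 (Nat.card (Nat.primesLE m × (τ → Option (Fin (m + 1))))) ≤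
      (Nat.card τ + 1) * Real.logb 2 (m + 2) := by
  have hpos : 0 < (Nat.primesLE m).card :=
    Finset.card_pos.2 ⟨2, Nat.mem_primesLE.2 ⟨hm, Nat.prime_two⟩⟩
  have hle : (Nat.primesLE m).card ≤ m + 2 := by
    rw [Nat.primesLE_eq_filter_range]
    exact (Finset.card_filter_le _ _).trans (by simp)
  rw [Nat.card_prod, Nat.cast_mul, Nat.card_eq_fintype_card (α := Nat.primesLE m),
    Fintype.card_coe, Real.logb_mul (by exact_mod_cast hpos.ne')
    (by exact_mod_cast Nat.card_pos.ne'), add_mul, one_mul, add_comm]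
  gcongr
  · exact logb_card_counter_le τ (by push_cast; linarith)
  · norm_num
  · exact_mod_cast hle

theorem hasCost_of_mem_SF (pad : α) {L : Language α} (h : L ∈ SF α) : HasCost pad loglog2 L := by
  obtain ⟨hreg, hSF⟩ := h
  obtain ⟨τ, _, M, rfl⟩ := exists_eq_reverse_accepts hreg
  intro ε hε
  have hε' : 0 < min ε 1 := lt_min hε one_pos
  refine ⟨(Nat.card τ + 1) * 5, ?_⟩
  filter_upwards [eventually_gt_atTop 0, eventually_logb_div_le_primeCounting hε',
    eventually_logb_ceil_le, tendsto_ceil_log2_pow_four.eventually_ge_atTop 2] with n hn hB hlog hm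
  obtain ⟨P, hP⟩ := exists_isFor_SW_of_suffixFree pad hSF hε' (min_le_right _ _) hn hm hB
  refine ⟨_, inferInstance, P, hP.mono (min_le_left _ _), ?_⟩
  calc _ ≤ (Nat.card τ + 1) * Real.logb 2 ((⌈log2 n ^ 4⌉₊ : ℝ) + 2) :=
        logb_card_randomPrimeCounter_le τ hm
    _ ≤ (Nat.card τ + 1) * 5 * loglog2 n := by
      rw [mul_assoc]
      gcongr

/-! ### The trivial upper and lower bounds -/

/-- The deterministic automaton that stores the window `lastN pad n`, the possible windows being
encoded in an arbitrary state set `σ`. -/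
noncomputable def windowAutomaton (pad : α) {n : ℕ} (L : Language α) {σ : Type*}
    (e : {l : List α // l.length = n} ≃ σ) : ProbAutomaton α σ where
  init := PMF.pure (e ⟨lastN pad n [], lastN_length pad n _⟩)
  step q a := PMF.pure (e ⟨lastN pad n ((e.symm q).1 ++ [a]), lastN_length pad n _⟩)
  accept := {q | (e.symm q).1 ∈ L}

theorem dist_windowAutomaton (pad : α) {n : ℕ} (L : Language α) {σ : Type*}
    (e : {l : List α // l.length = n} ≃ σ) (w : List α) :
    (windowAutomaton pad L e).dist w = PMF.pure (e ⟨lastN pad n w, lastN_length pad n _⟩) := by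
  induction w using List.reverseRecOn with
  | nil => rfl
  | append_singleton w a ih =>
    rw [ProbAutomaton.dist_snoc, ih, PMF.pure_bind]
    simp only [windowAutomaton, Equiv.symm_apply_apply, ← lastN_snoc]

open Classical in
theorem acceptProb_windowAutomaton (pad : α) {n : ℕ} (L : Language α) {σ : Type*}
    (e : {l : List α // l.length = n} ≃ σ) (w : List α) :
    (windowAutomaton pad L e).acceptProb w = if w ∈ SW pad n L then 1 else 0 := by
  have mem_accept : e ⟨lastN pad n w, lastN_length pad n _⟩ ∈ (windowAutomaton pad L e).accept ↔
      w ∈ SW pad n L := by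
    change (e.symm (e _)).1 ∈ L ↔ _
    rw [Equiv.symm_apply_apply]
    rfl
  rw [ProbAutomaton.acceptProb, dist_windowAutomaton, PMF.toOuterMeasure_pure_apply]
  simp only [mem_accept]
  split_ifs <;> simp

theorem isFor_windowAutomaton (pad : α) {n : ℕ} (L : Language α) {σ : Type*}
    (e : {l : List α // l.length = n} ≃ σ) {ε : ℝ} (hε : 0 ≤ ε) :
    (windowAutomaton pad L e).IsFor (SW pad n L) ε := by
  rw [ProbAutomaton.isFor_iff]
  exact ⟨fun w hw => by simp [acceptProb_windowAutomaton, hw, hε],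
    fun w hw => by simp [acceptProb_windowAutomaton, hw, hε]⟩

theorem randSpace_isBigO_linear [Finite α] (pad : α) (L : Language α) :
    randSpace pad L =O[atTop] fun n => (n : ℝ) := by
  have := Fintype.ofFinite α
  refine IsBigO.of_bound (Real.logb 2 (Nat.card α)) (Eventually.of_forall fun n => ?_)
  rw [Real.norm_of_nonneg (randSpace_nonneg _ _ _), Real.norm_natCast]
  have card_eq : Nat.card {l : List α // l.length = n} = Nat.card α ^ n := by
    rw [Nat.card_eq_fintype_card (α := α), ← card_vector n, ← Nat.card_eq_fintype_card]
    rfl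
  have : Finite {l : List α // l.length = n} := (List.finite_length_eq α n).to_subtype
  refine (randSpace_le (isFor_windowAutomaton pad L (Finite.equivFin _) (by norm_num))).trans ?_
  rw [Nat.card_fin, card_eq, Nat.cast_pow, Real.logb_pow, mul_comm]

theorem mem_SW_iff {pad : α} {L : Language α} (w : List α) : w ∈ SW pad w.length L ↔ w ∈ L := by
  change lastN pad _ w ∈ L ↔ _
  rw [lastN_of_le le_rfl]
  simp [List.rtake]

theorem le_randSpace_of_nontrivialAt [Finite α] {pad : α} {L : Language α} {n : ℕ}
    (h : NontrivialAt L n) : 1 / 15 ≤ randSpace pad L n := by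
  obtain ⟨⟨u, rfl, huL⟩, v, hv, hvL⟩ := h
  have huSW : u ∈ SW pad u.length L := (mem_SW_iff u).2 huL
  have hvSW : v ∉ SW pad u.length L := hv ▸ (mem_SW_iff v).not.2 hvL
  refine le_randSpace fun σ _ P hP => ?_
  simpa using le_logb_card_of_augmentedIndex hP 1 true (fun a => if a = [true] then u else v)
    (fun _ => []) fun b c r hk => by
      obtain rfl : b = [] := List.length_eq_zero_iff.1 (by omega)
      obtain rfl : r = [] := List.length_eq_zero_iff.1 (by omega)
      cases c <;> simp [huSW, hvSW]

/-! ### Classification -/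

theorem OmegaBar.not_isBigO {f g h : ℕ → ℝ} (hf : OmegaBar f g) (hh : h =o[atTop] g)
    (hg : Tendsto g atTop atTop) : ¬ f =O[atTop] h := by
  intro hfh
  obtain ⟨c, hc, hfreq⟩ := hf
  obtain ⟨n, hcg, hfg, hpos⟩ := (hfreq.and_eventually
    (((hfh.trans_isLittleO hh).bound (half_pos hc)).and (hg.eventually_gt_atTop 0))).exists
  rw [Real.norm_of_nonneg hpos.le, Real.norm_eq_abs] at hfg
  linarith [le_abs_self (f n), mul_pos hc hpos]

theorem isLittleO_one_loglog2 : (fun _ => (1 : ℝ)) =o[atTop] loglog2 :=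
  isLittleO_const_left.2 (Or.inr (tendsto_norm_atTop_atTop.comp tendsto_loglog2))

theorem isLittleO_logb_two_id : Real.logb 2 =o[atTop] (id : ℝ → ℝ) := by
  unfold Real.logb
  simp only [div_eq_inv_mul]
  exact Real.isLittleO_log_id_atTop.const_mul_left _

theorem isLittleO_loglog2_log2 : loglog2 =o[atTop] log2 :=
  isLittleO_logb_two_id.comp_tendsto tendsto_log2

theorem isLittleO_log2_natCast : log2 =o[atTop] fun n => (n : ℝ) :=
  isLittleO_logb_two_id.comp_tendsto tendsto_natCast_atTop_atTop

section Classification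

variable {L : Language α}

theorem hasCost_one_of_mem_boolComb [Finite α] (pad : α) (h : L ∈ BoolComb (ST α ∪ Len α)) :
    HasCost pad (fun _ => 1) L := by
  refine hasCost_of_mem_boolComb ?_ h
  rintro K (hK | hK)
  · exact hasCost_of_mem_ST pad hK
  · exact hasCost_of_mem_Len pad _ hK

theorem hasCost_loglog2_of_mem_boolComb [Finite α] (pad : α)
    (h : L ∈ BoolComb (ST α ∪ SF α ∪ Len α)) : HasCost pad loglog2 L := by
  refine hasCost_of_mem_boolComb ?_ h
  rintro K ((hK | hK) | hK)
  · refine (hasCost_of_mem_ST pad hK).mono ?_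
    simpa only [abs_one] using tendsto_loglog2.eventually_ge_atTop 1
  · exact hasCost_of_mem_SF pad hK
  · exact hasCost_of_mem_Len pad _ hK

theorem hasCost_log2_of_mem_boolComb (pad : α) (h : L ∈ BoolComb (LI α ∪ Len α)) :
    HasCost pad log2 L := by
  refine hasCost_of_mem_boolComb ?_ h
  rintro K (hK | hK)
  · exact hasCost_of_mem_LI pad hK
  · exact hasCost_of_mem_Len pad _ hK

variable [Finite α] (pad : α) (hL : L.IsRegular)
include hL

theorem omegaBar_loglog2_of_notMem_boolComb (h : L ∉ BoolComb (ST α ∪ Len α)) :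
    OmegaBar (randSpace pad L) loglog2 := by
  obtain ⟨σ, _, M, rfl⟩ := exists_eq_reverse_accepts hL
  exact omegaBar_loglog2_of_not_lengthDetermined pad fun hM =>
    h (mem_boolComb_ST_Len_of_lengthDetermined M hM)

theorem omegaBar_log2_of_notMem_boolComb (h : L ∉ BoolComb (ST α ∪ SF α ∪ Len α)) :
    OmegaBar (randSpace pad L) log2 := by
  obtain ⟨σ, _, M, rfl⟩ := exists_eq_reverse_accepts hL
  exact omegaBar_log2_of_not_lengthDetermined pad fun hM =>
    h (mem_boolComb_ST_SF_Len_of_lengthDetermined M hM)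

theorem omegaBar_linear_of_notMem_boolComb (h : L ∉ BoolComb (LI α ∪ Len α)) :
    OmegaBar (randSpace pad L) fun n => (n : ℝ) := by
  obtain ⟨σ, _, M, rfl⟩ := exists_eq_reverse_accepts hL
  exact omegaBar_linear_of_not_lengthDetermined pad fun hM =>
    h (mem_boolComb_LI_Len_of_lengthDetermined M hM)

end Classification

end SlidingWindow

open SlidingWindow Filter Asymptotics in
theorem mainTheorem2 {α : Type*} [Finite α] (pad : α) (L : Language α) (hL : L.IsRegular) :
    -- the four possible growth rates
    (ThetaOne L (randSpace pad L) ∨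
      ThetaBar (randSpace pad L) loglog2 ∨
      ThetaBar (randSpace pad L) log2 ∨
      ThetaBar (randSpace pad L) (fun n => (n : ℝ))) ∧
    -- the characterizations of the upper bounds
    (randSpace pad L =O[atTop] (fun _ => (1 : ℝ)) ↔ L ∈ BoolComb (ST α ∪ Len α)) ∧
    (randSpace pad L =O[atTop] loglog2 ↔ L ∈ BoolComb (ST α ∪ SF α ∪ Len α)) ∧
    (randSpace pad L =O[atTop] log2 ↔ L ∈ BoolComb (LI α ∪ Len α)) ∧
    -- the matching lower bounds
    (L ∉ BoolComb (ST α ∪ Len α) → OmegaBar (randSpace pad L) loglog2) ∧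
    (L ∉ BoolComb (ST α ∪ SF α ∪ Len α) → OmegaBar (randSpace pad L) log2) ∧
    (L ∉ BoolComb (LI α ∪ Len α) → OmegaBar (randSpace pad L) (fun n => (n : ℝ))) := by
  have upper₁ := fun h => (hasCost_one_of_mem_boolComb (L := L) pad h).isBigO
  have upper₂ := fun h => (hasCost_loglog2_of_mem_boolComb (L := L) pad h).isBigO
  have upper₃ := fun h => (hasCost_log2_of_mem_boolComb (L := L) pad h).isBigO
  have lower₁ := omegaBar_loglog2_of_notMem_boolComb pad hL
  have lower₂ := omegaBar_log2_of_notMem_boolComb pad hL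
  have lower₃ := omegaBar_linear_of_notMem_boolComb pad hL
  refine ⟨?_, ⟨fun h => by_contra fun h₁ => ?_, upper₁⟩, ⟨fun h => by_contra fun h₂ => ?_, upper₂⟩,
    ⟨fun h => by_contra fun h₃ => ?_, upper₃⟩, lower₁, lower₂, lower₃⟩
  · by_cases h₁ : L ∈ BoolComb (ST α ∪ Len α)
    · exact .inl ⟨upper₁ h₁, 1 / 15, by norm_num, fun n => le_randSpace_of_nontrivialAt⟩
    by_cases h₂ : L ∈ BoolComb (ST α ∪ SF α ∪ Len α)
    · exact .inr (.inl ⟨upper₂ h₂, lower₁ h₁⟩)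
    by_cases h₃ : L ∈ BoolComb (LI α ∪ Len α)
    · exact .inr (.inr (.inl ⟨upper₃ h₃, lower₂ h₂⟩))
    · exact .inr (.inr (.inr ⟨randSpace_isBigO_linear pad L, lower₃ h₃⟩))
  · exact (lower₁ h₁).not_isBigO isLittleO_one_loglog2 tendsto_loglog2 h
  · exact (lower₂ h₂).not_isBigO isLittleO_loglog2_log2 tendsto_log2 h
  · exact (lower₃ h₃).not_isBigO isLittleO_log2_natCast tendsto_natCast_atTop_atTop h
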